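/- **Notation.** Let $n\ge 2$. Let $\Delta^{(n)}=\{p\in\mathbb R^n: p_i>0 \text{ for all } i,\ \sum_i p_i=1\}$ be the open unit simplex with the Euclidean metric, $\overline{\Delta^{(n)}}$ its closure, $T\Delta^{(n)}=\{v\in\mathbb R^n:\sum_i v_i=0\}$, and $m$ the surface measure ($(n-1)$-dimensional Lebesgue measure) on $\Delta^{(n)}$. A *portfolio* is a Borel map $\pi:\Delta^{(n)}\to\overline{\Delta^{(n)}}$; $\frac{\pi(p)}{p}$ denotes the vector with components $\pi_i(p)/p_i$. Let $\mathcal{FG}$ be the set of pairs $(\pi,\Phi)$ where $\pi$ is a portfolio and $\Phi:\Delta^{(n)}\to(0,\infty)$ is a concave function generating it, i.e. $$1+\Big\langle \tfrac{\pi(p)}{p},q-p\Big\rangle\ \ge\ \frac{\Phi(q)}{\Phi(p)}\qquad\text{for all }p,q\in\Delta^{(n)}.$$ The L-divergence of $(\pi,\Phi)\in\mathcal{FG}$ is $$T(q\mid p)=\log\Big(1+\Big\langle \tfrac{\pi(p)}{p},q-p\Big\rangle\Big)-\log\frac{\Phi(q)}{\Phi(p)}.$$ For a Borel probability measure $\mathbb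 P$ on $\Delta^{(n)}\times\Delta^{(n)}$, $(\pi,\Phi)\in\mathcal{FG}$ is called *optimal for $\mathbb P$* if it maximizes $\int T(q\mid p)\,\mathrm d\mathbb P(p,q)$ over $\mathcal{FG}$. We call $\mathbb P$ *absolutely continuous* if $\mathbb P\ll m\otimes m$, and *discrete* if it is carried by a countable set. **Theorem.** Let $K\subset\Delta^{(n)}$ be compact, and let $\mathbb P$ be an absolutely continuous Borel probability measure on $\Delta^{(n)}\times\Delta^{(n)}$ supported on $K\times K$. Write $\mathbb P(\mathrm dp\,\mathrm dq)=\mathbb P_1(\mathrm dp)\,\mathbb P_2(\mathrm dq\mid p)$, where $\mathbb P_1(\mathrm dp)=f(p)\,m(\mathrm dp)$ is the first marginal and $\mathbb P_2(\cdot\mid p)$ is the conditional distribution of the second variable given $p$. Suppose that $\mathbb P$ satisfies the *support condition*: for $m$-almost all $p$ with $f(p)>0$, for every $v\in T\Delta^{(n)}$ there exists $\lambda>0$ such that $p+\lambda v$ belongs to the support of $\mathbb P_2(\cdot\mid p)$. Let $(\pi,\Phi)$ be optimal for $\mathbb P$. Let $(\mathbb P_N)_{N\ge1}$ be Borel probability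 measures on $\Delta^{(n)}\times\Delta^{(n)}$ supported on $K\times K$, each of them discrete or absolutely continuous, with $\mathbb P_N\to\mathbb P$ weakly, and let $(\widehat\pi^{(N)},\widehat\Phi^{(N)})$ be optimal for $\mathbb P_N$, for each $N\ge1$. Then $$\widehat\pi^{(N)}(p)\longrightarrow\pi(p)\qquad\text{for $m$-almost every $p$ with } f(p)>0 .$$ -/

import Mathlib

open MeasureTheory ProbabilityTheory Filter Topology
open scoped ENNReal

/-- The open unit simplex `Δ⁽ⁿ⁾` in Euclidean space `ℝⁿ`. -/
def openSimplex (n : ℕ) : Set (EuclideanSpace ℝ (Fin n)) :=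
  {p | (∀ i, 0 < p i) ∧ ∑ i, p i = 1}

/-- The closed unit simplex, i.e. the closure of `Δ⁽ⁿ⁾`. -/
def closedSimplex (n : ℕ) : Set (EuclideanSpace ℝ (Fin n)) :=
  {p | (∀ i, 0 ≤ p i) ∧ ∑ i, p i = 1}

/-- The surface measure `m` of `Δ⁽ⁿ⁾`: its `(n-1)`-dimensional Hausdorff measure, in the
normalization that agrees with Lebesgue measure on `(n-1)`-dimensional Euclidean spaces. -/
noncomputable def surfaceMeasure (n : ℕ) : Measure (openSimplex n) :=
  Measure.euclideanHausdorffMeasure (n - 1)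

/-- A portfolio: a Borel measurable map from the open to the closed simplex. -/
def IsPortfolio {n : ℕ} (π : openSimplex n → EuclideanSpace ℝ (Fin n)) : Prop :=
  Measurable π ∧ ∀ p, π p ∈ closedSimplex n

/-- `⟨π(p) / p, q - p⟩`, with the weight ratio `π(p) / p` taken componentwise. -/
noncomputable def weightRatioInner {n : ℕ} (π : openSimplex n → EuclideanSpace ℝ (Fin n))
    (p q : openSimplex n) : ℝ :=
  ∑ i, π p i / (p : EuclideanSpace ℝ (Fin n)) i *
    ((q : EuclideanSpace ℝ (Fin n)) i - (p : EuclideanSpace ℝ (Fin n)) i)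

/-- The pair `(π, Φ)` is a functionally generated portfolio: `π` is a portfolio, `Φ` is a positive
concave function on `Δ⁽ⁿ⁾`, and `Φ` generates `π`. The function `Φ` is written on the ambient
space so that concavity makes sense; its values outside `Δ⁽ⁿ⁾` play no role. -/
structure IsFunctionallyGenerated {n : ℕ} (π : openSimplex n → EuclideanSpace ℝ (Fin n))
    (Φ : EuclideanSpace ℝ (Fin n) → ℝ) : Prop where
  isPortfolio : IsPortfolio π
  pos : ∀ p ∈ openSimplex n, 0 < Φ p
  concaveOn : ConcaveOn ℝ (openSimplex n) Φ
  generates : ∀ p q : openSimplex n, Φ q / Φ p ≤ 1 + weightRatioInner π p q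

/-- The L-divergence `T(q | p)` of the pair `(π, Φ)`. -/
noncomputable def LDivergence {n : ℕ} (π : openSimplex n → EuclideanSpace ℝ (Fin n))
    (Φ : EuclideanSpace ℝ (Fin n) → ℝ) (q p : openSimplex n) : ℝ :=
  Real.log (1 + weightRatioInner π p q) - Real.log (Φ q / Φ p)

/-- `(π, Φ)` maximizes `∫ T(q | p) dP` over all functionally generated portfolios. For a `P` that
is supported on `K × K` with `K` compact, as below, each `T` is measurable and `P`-essentially
bounded, so all the integrals are finite. -/
def IsOptimalPortfolio {n : ℕ} (P : Measure (openSimplex n × openSimplex n))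
    (π : openSimplex n → EuclideanSpace ℝ (Fin n)) (Φ : EuclideanSpace ℝ (Fin n) → ℝ) : Prop :=
  IsFunctionallyGenerated π Φ ∧
    ∀ π' Φ', IsFunctionallyGenerated π' Φ' →
      ∫ z, LDivergence π' Φ' z.2 z.1 ∂P ≤ ∫ z, LDivergence π Φ z.2 z.1 ∂P

/-- A discrete measure: carried by a countable set of points. -/
def IsDiscreteMeasure {X : Type*} [MeasurableSpace X] (P : Measure X) : Prop :=
  ∃ S : Set X, S.Countable ∧ P Sᶜ = 0

/-- Absolute continuity of a measure on `Δ⁽ⁿ⁾ × Δ⁽ⁿ⁾` with respect to `m ⊗ m`. -/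
def IsAbsCont {n : ℕ} (P : Measure (openSimplex n × openSimplex n)) : Prop :=
  P ≪ (surfaceMeasure n).prod (surfaceMeasure n)

/-- The support condition, for a first marginal with density `f` with respect to `m` and
conditional distributions `κ p` of the second variable given the first: for `m`-almost all `p`
with `f p > 0`, every tangent vector `v` has some `λ > 0` such that `p + λ v` belongs to the
(topological) support of `κ p`. -/
def SupportCondition {n : ℕ} (f : openSimplex n → ℝ≥0∞)
    (κ : Kernel (openSimplex n) (openSimplex n)) : Prop :=
  ∀ᵐ p ∂(surfaceMeasure n), 0 < f p →
    ∀ v : EuclideanSpace ℝ (Fin n), ∑ i, v i = 0 →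
      ∃ l : ℝ, 0 < l ∧ ∃ q ∈ (κ p).support,
        (q : EuclideanSpace ℝ (Fin n)) = (p : EuclideanSpace ℝ (Fin n)) + l • v

/-! Put `φ = log Φ`. A pair is functionally generated when `π p` is a multiplicative supergradient
of `φ` at every `p` (`IsGenerator`). Normalized at a base point, such `φ` are locally
equi-Lipschitz, hence sequentially compact for pointwise convergence. Generators are unique where
`φ` is differentiable, so almost everywhere by Rademacher. Hence, if the logarithms converge to `φ'`
along a subsequence, the weights converge continuously, at almost every point, to the generator `π'`
of `φ'` (`exists_tendsto_generator`).

Optimality is used twice: for `P_N` against the average of `π` and the optimal weights, and for `P`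
against the optimal weights of `P_N`. In the limit (`integral_nonpos_of_tendsto`), strict concavity
of the logarithm forces `π` and `π'` to have equal returns `P`-almost surely, and the support
condition gives `π = π'` almost everywhere on `{f > 0}` (`ae_isGenerator_of_tendsto_optimal`).

That exceptional null set depends on the subsequence, and there are uncountably many subsequences. A
common null set is obtained from `φ` and `f` alone: at a density point of `{f ≠ 0}` where `φ` has a
unique generator, monotonicity of generators forces every generator of `φ'` to be `π p`
(`eq_of_isGenerator_of_density`). So every subsequential limit of the weights at `p` is `π p`. -/

/-! ### Generators of functions on the simplex -/

/-- The return `∑ wᵢ qᵢ / pᵢ` of the weights `w` when the market moves from `p` to `q`. -/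
noncomputable def relReturn {n : ℕ} (w : EuclideanSpace ℝ (Fin n)) (p q : openSimplex n) : ℝ :=
  ∑ i, w i * (q.1 i / p.1 i)

/-- The weights `w` generate `exp φ` at the point `p`. -/
def IsGenerator {n : ℕ} (φ : openSimplex n → ℝ) (p : openSimplex n)
    (w : EuclideanSpace ℝ (Fin n)) : Prop :=
  w ∈ closedSimplex n ∧ ∀ q, Real.exp (φ q - φ p) ≤ relReturn w p q

/-- The one-sided Lipschitz estimate of a logarithm of a generating function. -/
def IsLogLipschitz {n : ℕ} (φ : openSimplex n → ℝ) : Prop :=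
  ∀ ε > 0, ∀ p q : openSimplex n, (∀ i, ε ≤ p.1 i) → φ q - φ p ≤ dist q p / ε

section

variable {n : ℕ}

/-! ### Coordinates and relative returns. -/

lemma openSimplex.coord_pos (p : openSimplex n) (i : Fin n) : 0 < p.1 i := p.2.1 i

lemma openSimplex.coord_le_one (p : openSimplex n) (i : Fin n) : p.1 i ≤ 1 := by
  rw [← p.2.2]
  exact Finset.single_le_sum (f := fun i => p.1 i) (fun j _ => (p.2.1 j).le) (Finset.mem_univ i)

lemma openSimplex.exists_coord_lower_bound (p : openSimplex n) : ∃ ε > 0, ∀ i, ε ≤ p.1 i := by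
  have h : ∀ᶠ ε in 𝓝[>] (0 : ℝ), ∀ i, ε ≤ p.1 i :=
    eventually_all.2 fun i =>
      (eventually_le_nhds (openSimplex.coord_pos p i)).filter_mono nhdsWithin_le_nhds
  obtain ⟨ε, h1, h2⟩ := (h.and self_mem_nhdsWithin).exists
  exact ⟨ε, h2, h1⟩

lemma continuous_openSimplex_coord (i : Fin n) : Continuous fun p : openSimplex n => p.1 i := by
  fun_prop

lemma abs_coord_sub_le_dist (p q : openSimplex n) (i : Fin n) : |p.1 i - q.1 i| ≤ dist p q := by
  rw [Subtype.dist_eq, EuclideanSpace.dist_eq]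
  refine Real.le_sqrt_of_sq_le ?_
  rw [← Real.dist_eq]
  exact Finset.single_le_sum (f := fun i => dist (p.1 i) (q.1 i) ^ 2)
    (fun j _ => sq_nonneg _) (Finset.mem_univ i)

lemma isCompact_closedSimplex : IsCompact (closedSimplex n) := by
  refine Metric.isCompact_of_isClosed_isBounded ?_ ?_
  · have : closedSimplex n = (⋂ i, {p | 0 ≤ p i}) ∩ {p | ∑ i, p i = 1} := by
      ext p; simp [closedSimplex]
    rw [this]
    refine (isClosed_iInter fun i => isClosed_le continuous_const (by fun_prop)).inter
      (isClosed_eq (by fun_prop) continuous_const)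
  · refine (isBounded_iff_forall_norm_le).2 ⟨Real.sqrt n, fun p hp => ?_⟩
    rw [EuclideanSpace.norm_eq]
    refine Real.sqrt_le_sqrt ?_
    have h1 : ∀ i, p i ≤ 1 := fun i => by
      rw [← hp.2]
      exact Finset.single_le_sum (f := fun i => p i) (fun j _ => hp.1 j) (Finset.mem_univ i)
    calc ∑ i, ‖p i‖ ^ 2 ≤ ∑ _i : Fin n, (1 : ℝ) := Finset.sum_le_sum fun i _ => by
          rw [Real.norm_eq_abs, sq_abs]; nlinarith [h1 i, hp.1 i]
      _ = n := by simp

lemma relReturn_sub_one {w : EuclideanSpace ℝ (Fin n)} (hw : w ∈ closedSimplex n)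
    (p q : openSimplex n) : relReturn w p q - 1 = ∑ i, w i / p.1 i * (q.1 i - p.1 i) := by
  rw [relReturn, ← hw.2, ← Finset.sum_sub_distrib]
  refine Finset.sum_congr rfl fun i _ => ?_
  have := (openSimplex.coord_pos p i).ne'
  field_simp

lemma one_add_weightRatioInner {π : openSimplex n → EuclideanSpace ℝ (Fin n)}
    {p : openSimplex n} (h : π p ∈ closedSimplex n) (q : openSimplex n) :
    1 + weightRatioInner π p q = relReturn (π p) p q := by
  rw [weightRatioInner, ← relReturn_sub_one h]; ring

lemma continuous_relReturn : Continuous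
    fun x : EuclideanSpace ℝ (Fin n) × openSimplex n × openSimplex n =>
      relReturn x.1 x.2.1 x.2.2 := by
  unfold relReturn
  refine continuous_finsetSum _ fun i _ => ?_
  refine Continuous.mul (by fun_prop) (Continuous.div (by fun_prop) (by fun_prop) fun x => ?_)
  exact (openSimplex.coord_pos _ i).ne'

lemma relReturn_ge {w : EuclideanSpace ℝ (Fin n)} (hw : w ∈ closedSimplex n)
    {p q : openSimplex n} {ε : ℝ} (hq : ∀ i, ε ≤ q.1 i) : ε ≤ relReturn w p q := by
  have : ε = ∑ i, w i * ε := by rw [← Finset.sum_mul, hw.2, one_mul]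
  rw [this, relReturn]
  refine Finset.sum_le_sum fun i _ => mul_le_mul_of_nonneg_left ?_ (hw.1 i)
  rw [le_div_iff₀ (openSimplex.coord_pos p i)]
  have := openSimplex.coord_pos q i
  have := openSimplex.coord_pos p i
  have := openSimplex.coord_le_one p i
  nlinarith [hq i]

lemma relReturn_le {w : EuclideanSpace ℝ (Fin n)} (hw : w ∈ closedSimplex n)
    {p q : openSimplex n} {ε : ℝ} (hε : 0 < ε) (hp : ∀ i, ε ≤ p.1 i) :
    relReturn w p q ≤ 1 / ε := by
  have : 1 / ε = ∑ i, w i * (1 / ε) := by rw [← Finset.sum_mul, hw.2, one_mul]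
  rw [this, relReturn]
  refine Finset.sum_le_sum fun i _ => mul_le_mul_of_nonneg_left ?_ (hw.1 i)
  exact div_le_div₀ zero_le_one (openSimplex.coord_le_one q i) hε (hp i)

lemma relReturn_pos {w : EuclideanSpace ℝ (Fin n)} (hw : w ∈ closedSimplex n)
    (p q : openSimplex n) : 0 < relReturn w p q := by
  obtain ⟨ε, hε, h⟩ := openSimplex.exists_coord_lower_bound q
  exact hε.trans_le (relReturn_ge hw h)

/-- Weights in the closed simplex are determined by their inner products with tangent vectors. -/
lemma eq_of_sum_div_mul_le {w w' : EuclideanSpace ℝ (Fin n)} {p : openSimplex n}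
    (h : ∑ i, w i / p.1 i * (w i - w' i) ≤ ∑ i, w' i / p.1 i * (w i - w' i)) : w = w' := by
  -- Testing in the direction `w - w'` itself turns the inequality into a weighted sum of squares.
  have h0 : ∑ i, (w i - w' i) ^ 2 / p.1 i ≤ 0 := by
    rw [← sub_nonpos, ← Finset.sum_sub_distrib] at h
    refine le_of_eq_of_le (Finset.sum_congr rfl fun i _ => ?_) h
    ring
  have h1 : ∀ i ∈ Finset.univ, 0 ≤ (w i - w' i) ^ 2 / p.1 i := fun i _ =>
    div_nonneg (sq_nonneg _) (openSimplex.coord_pos p i).le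
  have h2 := (Finset.sum_eq_zero_iff_of_nonneg h1).1 (h0.antisymm (Finset.sum_nonneg h1))
  ext i
  have h3 := h2 i (Finset.mem_univ i)
  rw [div_eq_zero_iff, or_iff_left (openSimplex.coord_pos p i).ne'] at h3
  exact sub_eq_zero.1 (pow_eq_zero_iff two_ne_zero |>.1 h3)

/-! ### Equi-Lipschitz bounds, compactness and stability of generators. -/

/-- Since `x + 1 ≤ exp x`, the increment of `φ` is at most the `w`-average of `(q i - p i) / p i`.
Only the base point `p` has to stay away from the boundary, and the constant does not depend on `φ`.
-/
lemma sub_le_of_isGenerator {φ : openSimplex n → ℝ} {p : openSimplex n}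
    {w : EuclideanSpace ℝ (Fin n)} (h : IsGenerator φ p w) {ε : ℝ} (hε : 0 < ε)
    (hp : ∀ i, ε ≤ p.1 i) (q : openSimplex n) : φ q - φ p ≤ dist q p / ε := by
  have h1 : φ q - φ p ≤ relReturn w p q - 1 := by
    linarith [h.2 q, Real.add_one_le_exp (φ q - φ p)]
  refine h1.trans ?_
  rw [relReturn_sub_one h.1]
  have : dist q p / ε = ∑ i, w i * (dist q p / ε) := by rw [← Finset.sum_mul, h.1.2, one_mul]
  rw [this]
  refine Finset.sum_le_sum fun i _ => ?_
  rw [div_mul_eq_mul_div, mul_div_assoc]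
  refine mul_le_mul_of_nonneg_left ?_ (h.1.1 i)
  exact div_le_div₀ dist_nonneg ((le_abs_self _).trans (abs_coord_sub_le_dist q p i)) hε (hp i)

lemma isLogLipschitz_of_isGenerator {φ : openSimplex n → ℝ}
    {π : openSimplex n → EuclideanSpace ℝ (Fin n)} (h : ∀ p, IsGenerator φ p (π p)) :
    IsLogLipschitz φ :=
  fun _ hε p q hp => sub_le_of_isGenerator (h p) hε hp q

lemma IsLogLipschitz.abs_sub_le {φ : openSimplex n → ℝ} (h : IsLogLipschitz φ) {ε : ℝ}
    (hε : 0 < ε) {p q : openSimplex n} (hp : ∀ i, ε ≤ p.1 i) (hq : ∀ i, ε ≤ q.1 i) :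
    |φ q - φ p| ≤ dist q p / ε := by
  refine abs_sub_le_iff.2 ⟨h ε hε p q hp, ?_⟩
  rw [dist_comm]
  exact h ε hε q p hq

lemma eventually_coord_lower_bound (p : openSimplex n) :
    ∃ ε > 0, (∀ i, ε ≤ p.1 i) ∧ ∀ᶠ q in 𝓝 p, ∀ i, ε ≤ q.1 i := by
  obtain ⟨ε, hε, h⟩ := openSimplex.exists_coord_lower_bound p
  refine ⟨ε / 2, half_pos hε, fun i => (half_le_self hε.le).trans (h i), eventually_all.2 fun i => ?_⟩
  exact (continuous_openSimplex_coord i).continuousAt.eventually_const_le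
    ((half_lt_self hε).trans_le (h i))

lemma IsLogLipschitz.of_tendsto {φ : ℕ → openSimplex n → ℝ} {φ' : openSimplex n → ℝ}
    (h : ∀ k, IsLogLipschitz (φ k)) (hφ : ∀ p, Tendsto (fun k => φ k p) atTop (𝓝 (φ' p))) :
    IsLogLipschitz φ' := fun ε hε p q hp =>
  le_of_tendsto ((hφ q).sub (hφ p)) (Eventually.of_forall fun k => h k ε hε p q hp)

/-- Pointwise convergence of log-Lipschitz functions is continuous convergence. -/
lemma tendsto_uncurry_of_isLogLipschitz {φ : ℕ → openSimplex n → ℝ} {φ' : openSimplex n → ℝ}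
    (h : ∀ k, IsLogLipschitz (φ k)) (hφ : ∀ p, Tendsto (fun k => φ k p) atTop (𝓝 (φ' p)))
    (p : openSimplex n) :
    Tendsto (fun z : ℕ × openSimplex n => φ z.1 z.2) (atTop ×ˢ 𝓝 p) (𝓝 (φ' p)) := by
  obtain ⟨ε, hε, hp, hq⟩ := eventually_coord_lower_bound p
  have h1 : Tendsto (fun z : ℕ × openSimplex n => φ z.1 z.2 - φ z.1 p) (atTop ×ˢ 𝓝 p) (𝓝 0) := by
    refine squeeze_zero_norm' (a := fun z => dist z.2 p / ε) ?_ ?_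
    · filter_upwards [tendsto_snd.eventually hq] with z hz
      exact (h z.1).abs_sub_le hε hp hz
    · have : Tendsto (fun q : openSimplex n => dist q p / ε) (𝓝 p) (𝓝 (dist p p / ε)) :=
        (Continuous.div_const (by fun_prop) ε).tendsto p
      rw [dist_self, zero_div] at this
      exact this.comp tendsto_snd
  have h2 := h1.add ((hφ p).comp tendsto_fst)
  simpa using h2

lemma IsLogLipschitz.continuous {φ : openSimplex n → ℝ} (h : IsLogLipschitz φ) :
    Continuous φ := by
  refine continuous_iff_continuousAt.2 fun p => ?_
  have := tendsto_uncurry_of_isLogLipschitz (fun _ => h) (fun q => tendsto_const_nhds (x := φ q)) p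
  have h2 : Tendsto (fun z : ℕ × openSimplex n => φ z.2) (atTop ×ˢ 𝓝 p) (𝓝 (φ p)) := this
  rw [← Function.comp_def φ, ← tendsto_map'_iff, map_snd_prod] at h2
  exact h2

/-- A sequence of normalized log-Lipschitz functions has a pointwise convergent subsequence. -/
lemma exists_subseq_tendsto_of_isLogLipschitz {φ : ℕ → openSimplex n → ℝ}
    (h : ∀ k, IsLogLipschitz (φ k)) (p₀ : openSimplex n) (h0 : ∀ k, φ k p₀ = 0) :
    ∃ s : ℕ → ℕ, StrictMono s ∧ ∃ φ' : openSimplex n → ℝ,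
      ∀ p, Tendsto (fun k => φ (s k) p) atTop (𝓝 (φ' p)) := by
  have : Nonempty (openSimplex n) := ⟨p₀⟩
  have hB : ∀ p, ∃ B, ∀ k, φ k p ∈ Set.Icc (-B) B := fun p => by
    obtain ⟨ε, hε, hp⟩ := openSimplex.exists_coord_lower_bound p
    obtain ⟨ε', hε', hp'⟩ := openSimplex.exists_coord_lower_bound p₀
    refine ⟨dist p p₀ / min ε ε', fun k => ?_⟩
    have := (h k).abs_sub_le (lt_min hε hε') (p := p₀) (q := p)
      (fun i => (min_le_right _ _).trans (hp' i)) (fun i => (min_le_left _ _).trans (hp i))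
    rw [h0, sub_zero] at this
    exact abs_le.1 this
  choose B hB using hB
  -- Compactness of a countable product of intervals gives one subsequence converging on a dense
  -- sequence; the common Lipschitz bound then makes it Cauchy at every point.
  let d := TopologicalSpace.denseSeq (openSimplex n)
  have hc : IsCompact (Set.pi Set.univ fun j => Set.Icc (-B (d j)) (B (d j))) :=
    isCompact_univ_pi fun j => isCompact_Icc
  obtain ⟨y, -, s, hs, hy⟩ := hc.tendsto_subseq (x := fun k j => φ k (d j))
    (fun k j _ => hB (d j) k)
  rw [tendsto_pi_nhds] at hy
  refine ⟨s, hs, ?_⟩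
  suffices H : ∀ p, ∃ l, Tendsto (fun k => φ (s k) p) atTop (𝓝 l) by
    choose φ' hφ' using H
    exact ⟨φ', hφ'⟩
  intro p
  refine cauchySeq_tendsto_of_complete (Metric.cauchySeq_iff.2 fun e he => ?_)
  obtain ⟨ε, hε, hp, hq⟩ := eventually_coord_lower_bound p
  have hr : ∀ᶠ q in 𝓝 p, dist q p < ε * (e / 3) := Metric.ball_mem_nhds p (by positivity)
  obtain ⟨q, ⟨j, rfl⟩, hq1, hq2⟩ := Dense.inter_nhds_nonempty
    (TopologicalSpace.denseRange_denseSeq (openSimplex n)) (hq.and hr)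
  obtain ⟨M, hM⟩ := Metric.cauchySeq_iff.1 (hy j).cauchySeq (e / 3) (by positivity)
  have key : ∀ k, |φ (s k) (d j) - φ (s k) p| < e / 3 := fun k =>
    ((h (s k)).abs_sub_le hε hp hq1).trans_lt (by rwa [div_lt_iff₀' hε])
  refine ⟨M, fun a ha b hb => ?_⟩
  have h1 := abs_lt.1 (key a)
  have h2 := abs_lt.1 (key b)
  have h3 := abs_lt.1 (hM a ha b hb)
  rw [Real.dist_eq, abs_lt]
  simp only [Function.comp] at h3
  constructor <;> linarith [h1.1, h1.2, h2.1, h2.2, h3.1, h3.2]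

/-- The graph of the generator relation is closed. -/
lemma IsGenerator.of_tendsto {ι : Type*} {l : Filter ι} [l.NeBot]
    {φ : ι → openSimplex n → ℝ} {φ' : openSimplex n → ℝ} {x : ι → openSimplex n}
    {p : openSimplex n} {w : ι → EuclideanSpace ℝ (Fin n)} {w' : EuclideanSpace ℝ (Fin n)}
    (hφ : ∀ q, Tendsto (fun j => φ j q) l (𝓝 (φ' q)))
    (hφx : Tendsto (fun j => φ j (x j)) l (𝓝 (φ' p))) (hx : Tendsto x l (𝓝 p))
    (hw : Tendsto w l (𝓝 w')) (h : ∀ j, IsGenerator (φ j) (x j) (w j)) :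
    IsGenerator φ' p w' := by
  refine ⟨isCompact_closedSimplex.isClosed.mem_of_tendsto hw (Eventually.of_forall fun j => (h j).1),
    fun q => ?_⟩
  refine le_of_tendsto_of_tendsto
    ((Real.continuous_exp.tendsto _).comp ((hφ q).sub hφx))
    ((continuous_relReturn.tendsto (w', p, q)).comp
      (hw.prodMk_nhds (hx.prodMk_nhds tendsto_const_nhds)))
    (Eventually.of_forall fun j => (h j).2 q)

/-- Generators converge continuously at points where the limit has a unique generator. -/
lemma exists_tendsto_generator {φ : ℕ → openSimplex n → ℝ} {φ' : openSimplex n → ℝ}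
    {π : ℕ → openSimplex n → EuclideanSpace ℝ (Fin n)}
    (hφ : ∀ p, Tendsto (fun k => φ k p) atTop (𝓝 (φ' p)))
    (hπ : ∀ k p, IsGenerator (φ k) p (π k p)) {p : openSimplex n}
    (hu : ∀ w w', IsGenerator φ' p w → IsGenerator φ' p w' → w = w') :
    ∃ w, IsGenerator φ' p w ∧
      Tendsto (fun z : ℕ × openSimplex n => π z.1 z.2) (atTop ×ˢ 𝓝 p) (𝓝 w) := by
  have hL := fun k => isLogLipschitz_of_isGenerator (hπ k)
  -- By the closed graph, every cluster point of the weights generates `φ'` at `p`; uniqueness and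
  -- compactness of the closed simplex then give convergence.
  have hcl : ∀ w, MapClusterPt w (atTop ×ˢ 𝓝 p) (fun z : ℕ × openSimplex n => π z.1 z.2) →
      IsGenerator φ' p w := fun w hw => by
    obtain ⟨U, hU, hUw⟩ := mapClusterPt_iff_ultrafilter.1 hw
    refine IsGenerator.of_tendsto (l := (U : Filter (ℕ × openSimplex n)))
      (φ := fun z => φ z.1) (x := fun z => z.2) (w := fun z => π z.1 z.2)
      (fun q => ((hφ q).comp tendsto_fst).mono_left hU)
      ((tendsto_uncurry_of_isLogLipschitz hL hφ p).mono_left hU)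
      (tendsto_snd.mono_left hU) hUw (fun z => hπ z.1 z.2)
  have hmem : ∀ z : ℕ × openSimplex n, π z.1 z.2 ∈ closedSimplex n := fun z => (hπ z.1 z.2).1
  obtain ⟨w, -, hw⟩ := isCompact_closedSimplex.exists_mapClusterPt_of_frequently
    (l := atTop ×ˢ 𝓝 p) (f := fun z : ℕ × openSimplex n => π z.1 z.2)
    (Frequently.of_forall hmem)
  refine ⟨w, hcl w hw, ?_⟩
  exact isCompact_closedSimplex.tendsto_nhds_of_unique_mapClusterPt (Eventually.of_forall hmem)
    fun w' _ hw' => hu _ _ (hcl w' hw') (hcl w hw)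

/-! ### Weak convergence against continuously convergent integrands -/

/-- Lower `M`-Lipschitz envelope of the functions `h N` with `N ≥ M`. -/
noncomputable def lowerEnvelope {X : Type*} [PseudoMetricSpace X] (h : ℕ → X → ℝ) (M : ℕ)
    (x : X) : ℝ :=
  ⨅ z : {N : ℕ // M ≤ N} × X, (h z.1 z.2 + M * dist x z.2)

section Envelope

variable {X : Type*} [PseudoMetricSpace X] {h : ℕ → X → ℝ} {C : ℝ}

lemma lowerEnvelope_bddBelow (hC : ∀ N x, |h N x| ≤ C) (M : ℕ) (x : X) :
    BddBelow (Set.range fun z : {N : ℕ // M ≤ N} × X => h z.1 z.2 + M * dist x z.2) := by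
  refine ⟨-C, ?_⟩
  rintro _ ⟨z, rfl⟩
  have := (abs_le.1 (hC z.1 z.2)).1
  have : 0 ≤ (M : ℝ) * dist x z.2 := by positivity
  dsimp only
  linarith

lemma lowerEnvelope_le (hC : ∀ N x, |h N x| ≤ C) {M N : ℕ} (hMN : M ≤ N) (x : X) :
    lowerEnvelope h M x ≤ h N x := by
  have := ciInf_le (lowerEnvelope_bddBelow hC M x) (⟨N, hMN⟩, x)
  simpa [lowerEnvelope] using this

lemma abs_lowerEnvelope_le (hC : ∀ N x, |h N x| ≤ C) (M : ℕ) (x : X) :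
    |lowerEnvelope h M x| ≤ C := by
  have : Nonempty ({N : ℕ // M ≤ N} × X) := ⟨⟨M, le_rfl⟩, x⟩
  refine abs_le.2 ⟨le_ciInf fun z => ?_,
    (lowerEnvelope_le hC le_rfl x).trans (abs_le.1 (hC M x)).2⟩
  have := (abs_le.1 (hC z.1 z.2)).1
  have : 0 ≤ (M : ℝ) * dist x z.2 := by positivity
  linarith

lemma lipschitzWith_lowerEnvelope (hC : ∀ N x, |h N x| ≤ C) (M : ℕ) :
    LipschitzWith (M : NNReal) (lowerEnvelope h M) := by
  refine LipschitzWith.of_le_add_mul _ fun x y => ?_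
  have : Nonempty ({N : ℕ // M ≤ N} × X) := ⟨⟨M, le_rfl⟩, x⟩
  rw [← sub_le_iff_le_add]
  refine le_ciInf fun z => ?_
  have h1 := ciInf_le (lowerEnvelope_bddBelow hC M x) z
  have h2 : (M : ℝ) * dist x z.2 ≤ M * (dist x y + dist y z.2) :=
    mul_le_mul_of_nonneg_left (dist_triangle _ _ _) (by positivity)
  rw [mul_add] at h2
  rw [NNReal.coe_natCast, sub_le_iff_le_add]
  unfold lowerEnvelope
  linarith

/-- `M` is both the index threshold and the Lipschitz constant. As it grows, points far from `x` are
ruled out by the penalty, and near points only see late indices, where continuous convergence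
controls `h`. -/
lemma tendsto_lowerEnvelope (hC : ∀ N x, |h N x| ≤ C) {x : X} {y : ℝ}
    (hlim : Tendsto (fun z : ℕ × X => h z.1 z.2) (atTop ×ˢ 𝓝 x) (𝓝 y)) :
    Tendsto (fun M => lowerEnvelope h M x) atTop (𝓝 y) := by
  have hx : Tendsto (fun M => h M x) atTop (𝓝 y) :=
    hlim.comp (tendsto_id.prodMk (tendsto_const_nhds (x := x)))
  have hyC : y ≤ C := le_of_tendsto hx (Eventually.of_forall fun M => (abs_le.1 (hC M x)).2)
  refine tendsto_order.2 ⟨fun a ha => ?_, fun a ha => ?_⟩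
  · obtain ⟨b, hab, hby⟩ := exists_between ha
    have h1 := (tendsto_order.1 hlim).1 b hby
    obtain ⟨⟨N₀, δ⟩, ⟨-, hδ⟩, hN⟩ :=
      ((atTop_basis (α := ℕ)).prod Metric.nhds_basis_ball).mem_iff.1 h1
    -- Beyond distance `δ` the penalty is at least `2 * C`, which lifts `h ≥ -C` above `C ≥ y > b`.
    obtain ⟨N₁, hN₁⟩ := exists_nat_ge (2 * C / δ)
    filter_upwards [eventually_ge_atTop N₀, eventually_ge_atTop N₁] with M hM0 hM1
    have : Nonempty ({N : ℕ // M ≤ N} × X) := ⟨⟨M, le_rfl⟩, x⟩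
    refine hab.trans_le (le_ciInf fun z => ?_)
    have hMd : 0 ≤ (M : ℝ) * dist x z.2 := by positivity
    by_cases hz : dist z.2 x < δ
    · have : b < h z.1 z.2 := hN (a := ((z.1 : ℕ), z.2)) ⟨hM0.trans z.1.2, hz⟩
      linarith
    · rw [not_lt, dist_comm] at hz
      have h2 : 2 * C ≤ M * dist x z.2 := by
        have h3 : 2 * C / δ ≤ M := hN₁.trans (by exact_mod_cast hM1)
        rw [div_le_iff₀ hδ] at h3
        exact h3.trans (mul_le_mul_of_nonneg_left hz (by positivity))
      have := (abs_le.1 (hC z.1 z.2)).1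
      linarith
  · filter_upwards [(tendsto_order.1 hx).2 a ha] with M hM
    exact (lowerEnvelope_le hC le_rfl x).trans_lt hM

end Envelope

section WeakLimit

variable {X : Type*} [PseudoMetricSpace X] [MeasurableSpace X] [OpensMeasurableSpace X]
  {P : ProbabilityMeasure X} {PN : ℕ → ProbabilityMeasure X} {h : ℕ → X → ℝ} {h' : X → ℝ} {C : ℝ}

/-- For fixed `M` the envelope is a bounded continuous minorant of all `h N` with `N ≥ M`, so weak
convergence applies to it; dominated convergence then lets `M` tend to infinity. -/
lemma integral_nonpos_of_tendsto_of_bounded (hP : Tendsto PN atTop (𝓝 P))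
    (hm : ∀ N, Measurable (h N)) (hC : ∀ N x, |h N x| ≤ C)
    (hlim : ∀ᵐ x ∂(P : Measure X),
      Tendsto (fun z : ℕ × X => h z.1 z.2) (atTop ×ˢ 𝓝 x) (𝓝 (h' x)))
    (hint : ∀ N, ∫ x, h N x ∂(PN N : Measure X) ≤ 0) : ∫ x, h' x ∂(P : Measure X) ≤ 0 := by
  have hcont := fun M => (lipschitzWith_lowerEnvelope hC M).continuous
  have hg : ∀ M, ∫ x, lowerEnvelope h M x ∂(P : Measure X) ≤ 0 := fun M => by
    let F : BoundedContinuousFunction X ℝ := BoundedContinuousFunction.ofNormedAddCommGroup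
      (lowerEnvelope h M) (hcont M) C (abs_lowerEnvelope_le hC M)
    refine le_of_tendsto (ProbabilityMeasure.tendsto_iff_forall_integral_tendsto.1 hP F) ?_
    filter_upwards [eventually_ge_atTop M] with N hN
    refine le_trans (integral_mono (F.integrable _) ?_ (lowerEnvelope_le hC hN)) (hint N)
    exact Integrable.of_bound (hm N).aestronglyMeasurable C (Eventually.of_forall (hC N))
  refine le_of_tendsto (tendsto_integral_of_dominated_convergence (fun _ => C)
    (fun M => (hcont M).measurable.aestronglyMeasurable) (integrable_const C)
    (fun M => Eventually.of_forall (abs_lowerEnvelope_le hC M)) ?_) (Eventually.of_forall hg)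
  filter_upwards [hlim] with x hx using tendsto_lowerEnvelope hC hx

/-- If `PN → P` weakly and bounded integrands converge continuously at `P`-almost every point,
then nonpositivity of the integrals passes to the limit. -/
lemma integral_nonpos_of_tendsto (hP : Tendsto PN atTop (𝓝 P))
    (hm : ∀ N, Measurable (h N)) (hC : ∀ N, ∀ᵐ x ∂(PN N : Measure X), |h N x| ≤ C)
    (hC' : ∀ᵐ x ∂(P : Measure X), |h' x| ≤ C)
    (hlim : ∀ᵐ x ∂(P : Measure X),
      Tendsto (fun z : ℕ × X => h z.1 z.2) (atTop ×ˢ 𝓝 x) (𝓝 (h' x)))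
    (hint : ∀ N, ∫ x, h N x ∂(PN N : Measure X) ≤ 0) : ∫ x, h' x ∂(P : Measure X) ≤ 0 := by
  -- The bounds hold only almost everywhere, for a measure varying with `N`. Truncation at `±C`
  -- makes them hold everywhere, changes no integral and preserves continuous convergence.
  have hclip : ∀ y : ℝ, |y| ≤ C → max (-C) (min C y) = y := fun y hy => by
    rw [min_eq_right (abs_le.1 hy).2, max_eq_right (abs_le.1 hy).1]
  have hC0 : 0 ≤ C := by
    obtain ⟨x, hx⟩ := hC'.exists
    exact (abs_nonneg _).trans hx
  have key := integral_nonpos_of_tendsto_of_bounded (h := fun N x => max (-C) (min C (h N x)))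
    (h' := fun x => max (-C) (min C (h' x))) (C := C) hP
    (fun N => measurable_const.max (measurable_const.min (hm N)))
    (fun N x => abs_le.2 ⟨le_max_left _ _, max_le (by linarith) (min_le_left _ _)⟩)
    (by
      filter_upwards [hlim] with x hx
      exact tendsto_const_nhds.max (tendsto_const_nhds.min hx))
    (fun N => by
      rw [integral_congr_ae (g := h N)]
      · exact hint N
      · filter_upwards [hC N] with x hx using hclip _ hx)
  rwa [integral_congr_ae (g := h')] at key
  filter_upwards [hC'] with x hx using hclip _ hx

end WeakLimit

/-! ### A chart of the simplex -/

/-- The tangent space `TΔ⁽ⁿ⁾` of the simplex. -/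
noncomputable def simplexTangent (n : ℕ) : Submodule ℝ (EuclideanSpace ℝ (Fin n)) :=
  LinearMap.ker (∑ i, (EuclideanSpace.proj (𝕜 := ℝ) i : EuclideanSpace ℝ (Fin n) →L[ℝ] ℝ).toLinearMap)

lemma mem_simplexTangent {v : EuclideanSpace ℝ (Fin n)} :
    v ∈ simplexTangent n ↔ ∑ i, v i = 0 := by
  simp [simplexTangent]

lemma finrank_simplexTangent (hn : n ≠ 0) : Module.finrank ℝ (simplexTangent n) = n - 1 := by
  set L : EuclideanSpace ℝ (Fin n) →ₗ[ℝ] ℝ :=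
    ∑ i, (EuclideanSpace.proj (𝕜 := ℝ) i : EuclideanSpace ℝ (Fin n) →L[ℝ] ℝ).toLinearMap with hL
  have hL0 : L ≠ 0 := fun h => by
    have h1 : L (EuclideanSpace.single ⟨0, Nat.pos_of_ne_zero hn⟩ 1) = 1 := by simp [hL]
    rw [h] at h1
    simp at h1
  have h1 := LinearMap.finrank_range_add_finrank_ker L
  rw [LinearMap.range_eq_top.2 (LinearMap.surjective hL0), finrank_top, Module.finrank_self,
    finrank_euclideanSpace_fin] at h1
  have h2 : Module.finrank ℝ (simplexTangent n) = Module.finrank ℝ (LinearMap.ker L) := rfl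
  omega

/-- The chart `p ↦ p - p₀` of the simplex with values in its tangent space. -/
noncomputable def simplexChart (p₀ p : openSimplex n) : simplexTangent n :=
  ⟨p.1 - p₀.1, mem_simplexTangent.2 (by simp [p.2.2, p₀.2.2])⟩

lemma isometry_simplexChart (p₀ : openSimplex n) : Isometry (simplexChart p₀) := by
  refine Isometry.of_dist_eq fun p q => ?_
  rw [Subtype.dist_eq, Subtype.dist_eq]
  exact dist_sub_right _ _ _

lemma mem_openSimplex_add {p₀ : openSimplex n} {x : simplexTangent n}
    (hx : ∀ i, 0 < x.1 i + p₀.1 i) : x.1 + p₀.1 ∈ openSimplex n := by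
  refine ⟨fun i => hx i, ?_⟩
  have := mem_simplexTangent.1 x.2
  simp [Finset.sum_add_distrib, this, p₀.2.2]

lemma range_simplexChart (p₀ : openSimplex n) :
    Set.range (simplexChart p₀) = {x | ∀ i, 0 < x.1 i + p₀.1 i} := by
  ext x
  constructor
  · rintro ⟨p, rfl⟩ i
    simpa [simplexChart] using openSimplex.coord_pos p i
  · intro hx
    exact ⟨⟨_, mem_openSimplex_add hx⟩, Subtype.ext (by simp [simplexChart])⟩

lemma isOpen_range_simplexChart (p₀ : openSimplex n) : IsOpen (Set.range (simplexChart p₀)) := by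
  rw [range_simplexChart, Set.ofPred_forall]
  exact isOpen_iInter_of_finite fun i => isOpen_lt continuous_const (by fun_prop)

lemma isOpenEmbedding_simplexChart (p₀ : openSimplex n) : IsOpenEmbedding (simplexChart p₀) :=
  ⟨(isometry_simplexChart p₀).isEmbedding, isOpen_range_simplexChart p₀⟩

/-- An isometry preserves Hausdorff measure, which is Lebesgue measure on the tangent space. This
brings Rademacher's theorem and the density theorem to the simplex. -/
lemma surfaceMeasure_apply (p₀ : openSimplex n) (s : Set (openSimplex n)) :
    surfaceMeasure n s = volume (simplexChart p₀ '' s) := by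
  have hn : n ≠ 0 := by
    rintro rfl
    simpa using p₀.2.2
  rw [surfaceMeasure, ← (isometry_simplexChart p₀).euclideanHausdorffMeasure_image,
    ← InnerProductSpace.euclideanHausdorffMeasure_eq_volume, finrank_simplexTangent hn]

/-- The extension of a function on the simplex, read in the chart, by zero. -/
noncomputable def chartExtension (p₀ : openSimplex n) (φ : openSimplex n → ℝ) :
    simplexTangent n → ℝ :=
  Function.extend (simplexChart p₀) φ 0

lemma chartExtension_apply (p₀ : openSimplex n) (φ : openSimplex n → ℝ) (p : openSimplex n) :
    chartExtension p₀ φ (simplexChart p₀ p) = φ p :=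
  (isometry_simplexChart p₀).injective.extend_apply _ _ _

/-- Log-Lipschitz functions are differentiable almost everywhere. -/
lemma ae_differentiableAt_chartExtension (p₀ : openSimplex n) {φ : openSimplex n → ℝ}
    (h : IsLogLipschitz φ) : ∀ᵐ p ∂(surfaceMeasure n),
      DifferentiableAt ℝ (chartExtension p₀ φ) (simplexChart p₀ p) := by
  -- These open sets exhaust the simplex, and `φ` is Lipschitz with constant `k + 1` on the `k`-th.
  let U : ℕ → Set (simplexTangent n) := fun k => {x | ∀ i, 1 / ((k : ℝ) + 1) < x.1 i + p₀.1 i}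
  have hUo : ∀ k, IsOpen (U k) := fun k => by
    simp only [U, Set.ofPred_forall]
    exact isOpen_iInter_of_finite fun i => isOpen_lt continuous_const (by fun_prop)
  have hlip : ∀ k : ℕ, LipschitzOnWith ((k : NNReal) + 1) (chartExtension p₀ φ) (U k) := fun k => by
    have hk : (0 : ℝ) < 1 / ((k : ℝ) + 1) := by positivity
    have hex : ∀ x ∈ U k, ∃ p, simplexChart p₀ p = x := fun x hx => by
      rw [← Set.mem_range, range_simplexChart]
      exact fun i => hk.trans (hx i)
    have hco : ∀ p, simplexChart p₀ p ∈ U k → ∀ i, 1 / ((k : ℝ) + 1) ≤ p.1 i := fun p hp i => by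
      have := (hp i).le
      simpa [simplexChart] using this
    refine LipschitzOnWith.of_dist_le_mul fun x hx y hy => ?_
    obtain ⟨p, rfl⟩ := hex x hx
    obtain ⟨q, rfl⟩ := hex y hy
    rw [chartExtension_apply, chartExtension_apply, (isometry_simplexChart p₀).dist_eq,
      Real.dist_eq]
    refine (h.abs_sub_le hk (hco q hy) (hco p hx)).trans (le_of_eq ?_)
    push_cast
    field_simp
  have hae : ∀ᵐ x : simplexTangent n, ∀ k, x ∈ U k →
      DifferentiableWithinAt ℝ (chartExtension p₀ φ) (U k) x :=
    ae_all_iff.2 fun k => (hlip k).ae_differentiableWithinAt_of_mem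
  rw [ae_iff, surfaceMeasure_apply p₀]
  refine measure_mono_null ?_ (ae_iff.1 hae)
  rintro _ ⟨p, hp, rfl⟩ hx
  obtain ⟨ε, hε, hpε⟩ := openSimplex.exists_coord_lower_bound p
  obtain ⟨k, hk⟩ := exists_nat_one_div_lt hε
  have hpk : simplexChart p₀ p ∈ U k := fun i => by
    simpa [simplexChart] using hk.trans_le (hpε i)
  exact hp ((hx k hpk).differentiableAt ((hUo k).mem_nhds hpk))

/-- Generators are unique at points of differentiability. -/
lemma eq_of_isGenerator_of_differentiableAt {p₀ p : openSimplex n} {φ : openSimplex n → ℝ}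
    (hd : DifferentiableAt ℝ (chartExtension p₀ φ) (simplexChart p₀ p))
    {w w' : EuclideanSpace ℝ (Fin n)} (hw : IsGenerator φ p w) (hw' : IsGenerator φ p w') :
    w = w' := by
  set x := simplexChart p₀ p with hx
  have key : ∀ w, IsGenerator φ p w → ∀ v : simplexTangent n,
      fderiv ℝ (chartExtension p₀ φ) x v = ∑ i, w i / p.1 i * v.1 i := fun w hw v => by
    have hline : HasDerivAt (fun t : ℝ => x + t • v) v 0 := by
      simpa using ((hasDerivAt_id (0 : ℝ)).smul_const v).const_add x
    have hd' : HasFDerivAt (chartExtension p₀ φ) (fderiv ℝ (chartExtension p₀ φ) x)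
        (x + (0 : ℝ) • v) := by simpa using hd.hasFDerivAt
    have h1 : HasDerivAt (fun t : ℝ => chartExtension p₀ φ (x + t • v))
        (fderiv ℝ (chartExtension p₀ φ) x v) 0 := hd'.comp_hasDerivAt 0 hline
    -- The generator inequality says that this function of `t` is maximal at `0`, so its vanishing
    -- derivative identifies `fderiv` with the pairing against `w i / p i`.
    have h2 : HasDerivAt (fun t : ℝ => Real.exp (chartExtension p₀ φ (x + t • v) - φ p) -
        t * ∑ i, w i / p.1 i * v.1 i)
        (fderiv ℝ (chartExtension p₀ φ) x v - ∑ i, w i / p.1 i * v.1 i) 0 := by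
      have h3 := ((h1.sub_const (φ p)).exp).sub
        ((hasDerivAt_id (0 : ℝ)).mul_const (∑ i, w i / p.1 i * v.1 i))
      convert! h3 using 1
      simp [hx, chartExtension_apply]
    have hmax : IsLocalMax (fun t : ℝ => Real.exp (chartExtension p₀ φ (x + t • v) - φ p) -
        t * ∑ i, w i / p.1 i * v.1 i) 0 := by
      have hmem : ∀ᶠ t : ℝ in 𝓝 0, x + t • v ∈ Set.range (simplexChart p₀) :=
        hline.continuousAt.eventually_mem (by
          simpa using (isOpen_range_simplexChart p₀).mem_nhds ⟨p, hx.symm⟩)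
      filter_upwards [hmem] with t ht
      obtain ⟨q, hq⟩ := ht
      have h4 := hw.2 q
      have h5 := relReturn_sub_one hw.1 p q
      have h6 : ∀ i, q.1 i - p.1 i = t * v.1 i := fun i => by
        have h7 := congrArg (fun y : simplexTangent n => y.1 i) hq
        simp [hx, simplexChart] at h7
        linarith
      simp only [h6] at h5
      have h8 : ∑ i, w i / p.1 i * (t * v.1 i) = t * ∑ i, w i / p.1 i * v.1 i := by
        rw [Finset.mul_sum]
        exact Finset.sum_congr rfl fun i _ => by ring
      rw [h8] at h5
      have h9 : chartExtension p₀ φ x = φ p := chartExtension_apply p₀ φ p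
      simp only [zero_smul, add_zero, ← hq, chartExtension_apply, h9, sub_self, Real.exp_zero,
        zero_mul, sub_zero]
      linarith
    exact sub_eq_zero.1 (hmax.hasDerivAt_eq_zero h2)
  have hv : w - w' ∈ simplexTangent n := mem_simplexTangent.2 (by simp [hw.1.2, hw'.1.2])
  refine eq_of_sum_div_mul_le (p := p) (le_of_eq ?_)
  have h1 := key w hw ⟨_, hv⟩
  have h2 := key w' hw' ⟨_, hv⟩
  exact h1.symm.trans h2

lemma ae_unique_generator {φ : openSimplex n → ℝ} (h : IsLogLipschitz φ) :
    ∀ᵐ p ∂(surfaceMeasure n), ∀ w w', IsGenerator φ p w → IsGenerator φ p w' → w = w' := by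
  rcases isEmpty_or_nonempty (openSimplex n) with he | ⟨⟨p₀⟩⟩
  · exact Eventually.of_forall fun p => he.elim p
  filter_upwards [ae_differentiableAt_chartExtension p₀ h] with p hp w w' hw hw'
  exact eq_of_isGenerator_of_differentiableAt hp hw hw'

/-- Almost every point of a measurable set `S` is a point of density, and so every cone at that
point meets `S` in positive measure. -/
lemma ae_pos_measure_inter_cone {S : Set (openSimplex n)} (hS : MeasurableSet S) :
    ∀ᵐ p ∂(surfaceMeasure n), p ∈ S → ∀ v : EuclideanSpace ℝ (Fin n), ∑ i, v i = 0 →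
      ∀ ε : ℝ, 0 < ε → ∀ᶠ t in 𝓝[>] (0 : ℝ),
        surfaceMeasure n (S ∩ {q | ‖q.1 - p.1 - t • v‖ ≤ t * ε}) ≠ 0 := by
  rcases isEmpty_or_nonempty (openSimplex n) with he | ⟨⟨p₀⟩⟩
  · exact Eventually.of_forall fun p => he.elim p
  have hemb := (isOpenEmbedding_simplexChart p₀).measurableEmbedding
  have hae : ∀ᵐ x : simplexTangent n, x ∈ simplexChart p₀ '' S → ∀ k : ℕ, _ :=
    (ae_restrict_iff' (hemb.measurableSet_image.2 hS)).1 (ae_all_iff.2 fun k : ℕ =>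
      IsUnifLocDoublingMeasure.ae_tendsto_measure_inter_div (volume : Measure (simplexTangent n))
        (simplexChart p₀ '' S) k)
  rw [ae_iff, surfaceMeasure_apply p₀]
  refine measure_mono_null ?_ (ae_iff.1 hae)
  rintro _ ⟨p, hp, rfl⟩ hx
  refine hp fun hpS v hv ε hε => ?_
  -- The balls of radius `t * ε` about `p + t • v` are not centred at `p`, but their `k`-fold
  -- dilates contain `p`, which the density theorem for doubling measures allows.
  obtain ⟨k, hk⟩ := exists_nat_ge (‖v‖ / ε)
  let v' : simplexTangent n := ⟨v, mem_simplexTangent.2 hv⟩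
  have hlim := hx ⟨p, hpS, rfl⟩ k (l := 𝓝[>] (0 : ℝ))
    (fun t => simplexChart p₀ p + t • v') (fun t => t * ε)
    (tendsto_nhdsWithin_iff.2 ⟨by
      have : Tendsto (fun t : ℝ => t * ε) (𝓝 0) (𝓝 (0 * ε)) :=
        (continuous_id.mul continuous_const).tendsto 0
      rw [zero_mul] at this
      exact this.mono_left nhdsWithin_le_nhds,
      eventually_nhdsWithin_of_forall fun t ht => mul_pos ht hε⟩)
    (eventually_nhdsWithin_of_forall fun t ht => by
      rw [Metric.mem_closedBall, dist_self_add_right, norm_smul, Real.norm_of_nonneg (le_of_lt ht)]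
      have h1 : ‖v'‖ ≤ k * ε := by rwa [div_le_iff₀ hε] at hk
      have h2 := mul_le_mul_of_nonneg_left h1 (le_of_lt ht)
      linarith)
  filter_upwards [hlim.eventually_ne one_ne_zero] with t ht h0
  refine ht ?_
  rw [surfaceMeasure_apply p₀] at h0
  rw [ENNReal.div_eq_zero_iff]
  left
  refine measure_mono_null ?_ h0
  rintro _ ⟨⟨q, hq, rfl⟩, hq2⟩
  refine ⟨q, ⟨hq, ?_⟩, rfl⟩
  rw [Metric.mem_closedBall, dist_eq_norm] at hq2
  refine le_of_eq_of_le ?_ hq2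
  rw [← Submodule.norm_coe]
  congr 1
  simp [simplexChart, v']
  abel

/-! ### Functionally generated portfolios -/

lemma convex_openSimplex : Convex ℝ (openSimplex n) := by
  intro x hx y hy a b ha hb hab
  refine ⟨fun i => ?_, ?_⟩
  · have hxi := hx.1 i
    have hyi := hy.1 i
    simp only [PiLp.add_apply, PiLp.smul_apply, smul_eq_mul]
    rcases ha.eq_or_lt with rfl | ha
    · rw [zero_add] at hab
      simpa [hab] using hyi
    · exact add_pos_of_pos_of_nonneg (mul_pos ha hxi) (mul_nonneg hb hyi.le)
  · simp [Finset.sum_add_distrib, ← Finset.mul_sum, hx.2, hy.2, hab]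

/-- A positive function generating a portfolio is an infimum of affine functions, so concave. -/
lemma concaveOn_of_generates {π : openSimplex n → EuclideanSpace ℝ (Fin n)}
    {Φ : EuclideanSpace ℝ (Fin n) → ℝ} (hpos : ∀ p ∈ openSimplex n, 0 < Φ p)
    (h : ∀ p q : openSimplex n, Φ q / Φ p ≤ 1 + weightRatioInner π p q) :
    ConcaveOn ℝ (openSimplex n) Φ := by
  refine ⟨convex_openSimplex, fun x hx y hy a b ha hb hab => ?_⟩
  have hz := convex_openSimplex hx hy ha hb hab
  set z := a • x + b • y with hzdef
  have h1 := h ⟨z, hz⟩ ⟨x, hx⟩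
  have h2 := h ⟨z, hz⟩ ⟨y, hy⟩
  rw [div_le_iff₀ (hpos z hz)] at h1 h2
  have h3 : a * weightRatioInner π ⟨z, hz⟩ ⟨x, hx⟩ + b * weightRatioInner π ⟨z, hz⟩ ⟨y, hy⟩ = 0 := by
    simp only [weightRatioInner, Finset.mul_sum, ← Finset.sum_add_distrib]
    refine Finset.sum_eq_zero fun i _ => ?_
    have h4 : a * (x i - z i) + b * (y i - z i) = 0 := by
      have : z i = a * x i + b * y i := by simp [hzdef]
      have hb' : b = 1 - a := by linarith
      rw [this, hb']
      ring
    linear_combination (π ⟨z, hz⟩ i / z i) * h4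
  have h5 := mul_le_mul_of_nonneg_left h1 ha
  have h6 := mul_le_mul_of_nonneg_left h2 hb
  have h7 : a * ((1 + weightRatioInner π ⟨z, hz⟩ ⟨x, hx⟩) * Φ z) +
      b * ((1 + weightRatioInner π ⟨z, hz⟩ ⟨y, hy⟩) * Φ z) = Φ z := by
    linear_combination Φ z * h3 + Φ z * hab
  simp only [smul_eq_mul]
  simp only at h5 h6
  linarith

lemma mem_closedSimplex_midpoint {w w' : EuclideanSpace ℝ (Fin n)} (hw : w ∈ closedSimplex n)
    (hw' : w' ∈ closedSimplex n) : (1 / 2 : ℝ) • (w + w') ∈ closedSimplex n := by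
  refine ⟨fun i => ?_, ?_⟩
  · have h1 := hw.1 i
    have h2 := hw'.1 i
    simp only [PiLp.add_apply, PiLp.smul_apply, smul_eq_mul]
    linarith
  · simp only [PiLp.add_apply, PiLp.smul_apply, smul_eq_mul, ← Finset.mul_sum,
      Finset.sum_add_distrib, hw.2, hw'.2]
    norm_num

lemma relReturn_midpoint (w w' : EuclideanSpace ℝ (Fin n)) (p q : openSimplex n) :
    relReturn ((1 / 2 : ℝ) • (w + w')) p q = (relReturn w p q + relReturn w' p q) / 2 := by
  simp only [relReturn, PiLp.add_apply, PiLp.smul_apply, smul_eq_mul]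
  rw [← Finset.sum_add_distrib, Finset.sum_div]
  exact Finset.sum_congr rfl fun i _ => by ring

/-- The average of two functionally generated portfolios is generated by the geometric mean. -/
lemma IsFunctionallyGenerated.midpoint {π π' : openSimplex n → EuclideanSpace ℝ (Fin n)}
    {Φ Φ' : EuclideanSpace ℝ (Fin n) → ℝ} (h : IsFunctionallyGenerated π Φ)
    (h' : IsFunctionallyGenerated π' Φ') :
    IsFunctionallyGenerated (fun p => (1 / 2 : ℝ) • (π p + π' p))
      (fun x => Real.sqrt (Φ x * Φ' x)) := by
  have hpos : ∀ p ∈ openSimplex n, 0 < Real.sqrt (Φ p * Φ' p) := fun p hp =>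
    Real.sqrt_pos.2 (mul_pos (h.pos p hp) (h'.pos p hp))
  have hmem := fun p => mem_closedSimplex_midpoint (h.isPortfolio.2 p) (h'.isPortfolio.2 p)
  have hgen : ∀ p q : openSimplex n, Real.sqrt (Φ q * Φ' q) / Real.sqrt (Φ p * Φ' p) ≤
      1 + weightRatioInner (fun p => (1 / 2 : ℝ) • (π p + π' p)) p q := fun p q => by
    rw [one_add_weightRatioInner (hmem p), relReturn_midpoint]
    have h1 := h.generates p q
    have h2 := h'.generates p q
    rw [one_add_weightRatioInner (h.isPortfolio.2 p)] at h1
    rw [one_add_weightRatioInner (h'.isPortfolio.2 p)] at h2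
    have hp := h.pos p p.2
    have hp' := h'.pos p p.2
    have hq := h.pos q q.2
    have hq' := h'.pos q q.2
    have ha := relReturn_pos (h.isPortfolio.2 p) p q
    have ha' := relReturn_pos (h'.isPortfolio.2 p) p q
    rw [← Real.sqrt_div (mul_pos hq hq').le]
    refine (Real.sqrt_le_left (by positivity)).2 ?_
    have h3 : Φ q * Φ' q / (Φ p * Φ' p) = (Φ q / Φ p) * (Φ' q / Φ' p) := by field_simp
    rw [h3]
    -- The product of the two generating inequalities, followed by AM-GM for the two returns.
    have h4 := mul_le_mul h1 h2 (by positivity) ha.le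
    nlinarith [sq_nonneg (relReturn (π p) p q - relReturn (π' p) p q)]
  exact ⟨⟨(h.isPortfolio.1.add h'.isPortfolio.1).const_smul (1 / 2 : ℝ), hmem⟩, hpos,
    concaveOn_of_generates hpos hgen, hgen⟩

/-- The logarithm of a generating function, normalized to vanish at `p₀`. -/
noncomputable def normalizedLog (p₀ : openSimplex n) (Φ : EuclideanSpace ℝ (Fin n) → ℝ)
    (p : openSimplex n) : ℝ :=
  Real.log (Φ p) - Real.log (Φ p₀)

lemma IsFunctionallyGenerated.isGenerator {π : openSimplex n → EuclideanSpace ℝ (Fin n)}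
    {Φ : EuclideanSpace ℝ (Fin n) → ℝ} (h : IsFunctionallyGenerated π Φ)
    (p₀ p : openSimplex n) : IsGenerator (normalizedLog p₀ Φ) p (π p) := by
  refine ⟨h.isPortfolio.2 p, fun q => ?_⟩
  rw [normalizedLog, normalizedLog, sub_sub_sub_cancel_right, Real.exp_sub,
    Real.exp_log (h.pos q q.2), Real.exp_log (h.pos p p.2),
    ← one_add_weightRatioInner (h.isPortfolio.2 p)]
  exact h.generates p q

/-- The L-divergence of weights `w` at `p` in terms of the log-generating function. -/
noncomputable def logGap (φ : openSimplex n → ℝ) (w : EuclideanSpace ℝ (Fin n))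
    (p q : openSimplex n) : ℝ :=
  Real.log (relReturn w p q) - (φ q - φ p)

lemma IsFunctionallyGenerated.lDivergence_eq {π : openSimplex n → EuclideanSpace ℝ (Fin n)}
    {Φ : EuclideanSpace ℝ (Fin n) → ℝ} (h : IsFunctionallyGenerated π Φ)
    (p₀ p q : openSimplex n) :
    LDivergence π Φ q p = logGap (normalizedLog p₀ Φ) (π p) p q := by
  rw [LDivergence, one_add_weightRatioInner (h.isPortfolio.2 p),
    Real.log_div (h.pos q q.2).ne' (h.pos p p.2).ne', logGap, normalizedLog, normalizedLog]
  ring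

lemma normalizedLog_midpoint {Φ Φ' : EuclideanSpace ℝ (Fin n) → ℝ}
    (h : ∀ p ∈ openSimplex n, 0 < Φ p) (h' : ∀ p ∈ openSimplex n, 0 < Φ' p)
    (p₀ : openSimplex n) :
    normalizedLog p₀ (fun x => Real.sqrt (Φ x * Φ' x)) =
      fun p => (normalizedLog p₀ Φ p + normalizedLog p₀ Φ' p) / 2 := by
  funext p
  have hlog : ∀ p : openSimplex n,
      Real.log (Real.sqrt (Φ p * Φ' p)) = (Real.log (Φ p) + Real.log (Φ' p)) / 2 := fun p => by
    rw [Real.log_sqrt (mul_pos (h p p.2) (h' p p.2)).le,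
      Real.log_mul (h p p.2).ne' (h' p p.2).ne']
  simp only [normalizedLog, hlog]
  ring

lemma log_add_log_le_two_mul_log {a b : ℝ} (ha : 0 < a) (hb : 0 < b) :
    (Real.log a + Real.log b) / 2 ≤ Real.log ((a + b) / 2) := by
  have h : Real.log a + Real.log b ≤ Real.log (((a + b) / 2) ^ 2) := by
    rw [← Real.log_mul ha.ne' hb.ne']
    exact Real.log_le_log (by positivity) (by nlinarith [sq_nonneg (a - b)])
  rw [Real.log_pow] at h
  push_cast at h
  linarith

lemma eq_of_log_midpoint_eq {a b : ℝ} (ha : 0 < a) (hb : 0 < b)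
    (h : Real.log ((a + b) / 2) = (Real.log a + Real.log b) / 2) : a = b := by
  have h1 : Real.log (((a + b) / 2) ^ 2) = Real.log (a * b) := by
    rw [Real.log_pow, Real.log_mul ha.ne' hb.ne']
    push_cast
    linarith
  have h2 := Real.log_injOn_pos (Set.mem_Ioi.2 (by positivity)) (Set.mem_Ioi.2 (by positivity)) h1
  have h3 : (a - b) ^ 2 = 0 := by linarith
  exact sub_eq_zero.1 (pow_eq_zero_iff two_ne_zero |>.1 h3)

lemma IsCompact.exists_coord_lower_bound {K : Set (openSimplex n)} (hK : IsCompact K) :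
    ∃ ε > 0, ∀ p ∈ K, ∀ i, ε ≤ p.1 i := by
  refine hK.induction_on (p := fun s => ∃ ε > 0, ∀ p ∈ s, ∀ i, ε ≤ p.1 i)
    ⟨1, one_pos, by simp⟩ ?_ ?_ ?_
  · rintro s t hst ⟨ε, hε, h⟩
    exact ⟨ε, hε, fun p hp => h p (hst hp)⟩
  · rintro s t ⟨ε, hε, h⟩ ⟨ε', hε', h'⟩
    refine ⟨min ε ε', lt_min hε hε', fun p hp i => ?_⟩
    rcases hp with hp | hp
    · exact (min_le_left _ _).trans (h p hp i)
    · exact (min_le_right _ _).trans (h' p hp i)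
  · intro p _
    obtain ⟨ε, hε, -, h⟩ := eventually_coord_lower_bound p
    exact ⟨_, mem_nhdsWithin_of_mem_nhds h, ε, hε, fun q hq => hq⟩

/-- L-divergences are uniformly bounded over compact sets. -/
lemma exists_abs_logGap_le {K : Set (openSimplex n)} (hK : IsCompact K) :
    ∃ C, ∀ φ : openSimplex n → ℝ, IsLogLipschitz φ → ∀ w ∈ closedSimplex n,
      ∀ p ∈ K, ∀ q ∈ K, |logGap φ w p q| ≤ C := by
  obtain ⟨ε, hε, h⟩ := hK.exists_coord_lower_bound
  -- Returns lie in `[ε, 1 / ε]`, and `φ` is `1 / ε`-Lipschitz on `K`.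
  refine ⟨-Real.log ε + Metric.diam K / ε, fun φ hφ w hw p hp q hq => ?_⟩
  refine (abs_sub _ _).trans (add_le_add ?_ ?_)
  · have h1 := Real.log_le_log hε (relReturn_ge hw (p := p) (h q hq))
    have h2 := Real.log_le_log (relReturn_pos hw p q) (relReturn_le hw hε (h p hp))
    rw [one_div, Real.log_inv] at h2
    exact abs_le.2 ⟨by linarith, h2⟩
  · exact (hφ.abs_sub_le hε (h p hp) (h q hq)).trans
      (div_le_div_of_nonneg_right (Metric.dist_le_diam_of_mem hK.isBounded hq hp) hε.le)

lemma measurable_logGap {φ : openSimplex n → ℝ} (hφ : IsLogLipschitz φ)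
    {π : openSimplex n → EuclideanSpace ℝ (Fin n)} (hπ : Measurable π) :
    Measurable fun z : openSimplex n × openSimplex n => logGap φ (π z.1) z.1 z.2 := by
  have h1 : Measurable fun z : openSimplex n × openSimplex n => relReturn (π z.1) z.1 z.2 :=
    continuous_relReturn.measurable.comp ((hπ.comp measurable_fst).prodMk measurable_id)
  have h2 := hφ.continuous.measurable
  exact h1.log.sub ((h2.comp measurable_snd).sub (h2.comp measurable_fst))

lemma IsLogLipschitz.midpoint {φ φ' : openSimplex n → ℝ} (h : IsLogLipschitz φ)
    (h' : IsLogLipschitz φ') : IsLogLipschitz fun p => (φ p + φ' p) / 2 :=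
  fun ε hε p q hp => by linarith [h ε hε p q hp, h' ε hε p q hp]

/-- L-divergences converge continuously where the weights do. -/
lemma tendsto_logGap {φ : ℕ → openSimplex n → ℝ} {φ' : openSimplex n → ℝ}
    {π : ℕ → openSimplex n → EuclideanSpace ℝ (Fin n)} {w : EuclideanSpace ℝ (Fin n)}
    (hφ : ∀ k, IsLogLipschitz (φ k)) (hlim : ∀ p, Tendsto (fun k => φ k p) atTop (𝓝 (φ' p)))
    {z : openSimplex n × openSimplex n} (hw : w ∈ closedSimplex n)
    (hπ : Tendsto (fun x : ℕ × openSimplex n => π x.1 x.2) (atTop ×ˢ 𝓝 z.1) (𝓝 w)) :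
    Tendsto (fun x : ℕ × openSimplex n × openSimplex n =>
      logGap (φ x.1) (π x.1 x.2.1) x.2.1 x.2.2) (atTop ×ˢ 𝓝 z) (𝓝 (logGap φ' w z.1 z.2)) := by
  have h1 : Tendsto (fun x : ℕ × openSimplex n × openSimplex n => x.2.1) (atTop ×ˢ 𝓝 z) (𝓝 z.1) :=
    (continuous_fst.tendsto z).comp tendsto_snd
  have h2 : Tendsto (fun x : ℕ × openSimplex n × openSimplex n => x.2.2) (atTop ×ˢ 𝓝 z) (𝓝 z.2) :=
    (continuous_snd.tendsto z).comp tendsto_snd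
  have h3 := hπ.comp (tendsto_fst.prodMk h1)
  have h4 := (tendsto_uncurry_of_isLogLipschitz hφ hlim z.2).comp (tendsto_fst.prodMk h2)
  have h5 := (tendsto_uncurry_of_isLogLipschitz hφ hlim z.1).comp (tendsto_fst.prodMk h1)
  have h6 := (continuous_relReturn.tendsto (w, z.1, z.2)).comp
    (h3.prodMk_nhds (h1.prodMk_nhds h2))
  exact (h6.log (relReturn_pos hw z.1 z.2).ne').sub (h4.sub h5)

/-! ### Limits of optimal portfolios -/

/-- Weights agreeing on a set of market moves that meets every tangent direction are equal. -/
lemma eq_of_relReturn_eq_on_support {μ : Measure (openSimplex n)} {p : openSimplex n}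
    {w w' : EuclideanSpace ℝ (Fin n)} (hw : w ∈ closedSimplex n) (hw' : w' ∈ closedSimplex n)
    (hae : ∀ᵐ q ∂μ, relReturn w p q = relReturn w' p q)
    (hsupp : ∀ v : EuclideanSpace ℝ (Fin n), ∑ i, v i = 0 →
      ∃ l : ℝ, 0 < l ∧ ∃ q ∈ μ.support, (q : EuclideanSpace ℝ (Fin n)) = p.1 + l • v) :
    w = w' := by
  -- The single direction `w - w'` suffices. By continuity in `q`, the almost sure equality of
  -- returns extends to the support.
  obtain ⟨l, hl, q, hq, hqv⟩ := hsupp (w - w') (by simp [hw.2, hw'.2])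
  have hcont : ∀ w : EuclideanSpace ℝ (Fin n), Continuous fun q => relReturn w p q := fun w =>
    continuous_relReturn.comp (continuous_const.prodMk (continuous_const.prodMk continuous_id))
  have heq : relReturn w p q = relReturn w' p q :=
    Measure.support_subset_of_isClosed (isClosed_eq (hcont w) (hcont w')) hae hq
  have hco : ∀ i, q.1 i - p.1 i = l * (w i - w' i) := fun i => by simp [hqv]
  have h1 := relReturn_sub_one hw p q
  have h2 := relReturn_sub_one hw' p q
  rw [heq, h2] at h1
  simp only [hco, mul_left_comm _ l, ← Finset.mul_sum] at h1
  exact eq_of_sum_div_mul_le (mul_left_cancel₀ hl.ne' h1).ge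

/-- The limit of optimal portfolios coincides with the optimal portfolio of the limit measure. -/
lemma ae_isGenerator_of_tendsto_optimal {K : Set (openSimplex n)} (hK : IsCompact K)
    {P : ProbabilityMeasure (openSimplex n × openSimplex n)}
    (hPK : (P : Measure (openSimplex n × openSimplex n)) (K ×ˢ K)ᶜ = 0)
    {f : openSimplex n → ℝ≥0∞} (hf : Measurable f)
    (hPf : (P : Measure (openSimplex n × openSimplex n)).fst = (surfaceMeasure n).withDensity f)
    {κ : Kernel (openSimplex n) (openSimplex n)} [IsMarkovKernel κ]
    (hPκ : (P : Measure (openSimplex n × openSimplex n)) =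
      (P : Measure (openSimplex n × openSimplex n)).fst ⊗ₘ κ)
    (hsupp : SupportCondition f κ)
    {π : openSimplex n → EuclideanSpace ℝ (Fin n)} {Φ : EuclideanSpace ℝ (Fin n) → ℝ}
    (hopt : IsOptimalPortfolio (P : Measure (openSimplex n × openSimplex n)) π Φ)
    {PN : ℕ → ProbabilityMeasure (openSimplex n × openSimplex n)}
    (hPNK : ∀ N, (PN N : Measure (openSimplex n × openSimplex n)) (K ×ˢ K)ᶜ = 0)
    (hconv : Tendsto PN atTop (𝓝 P))
    {πN : ℕ → openSimplex n → EuclideanSpace ℝ (Fin n)}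
    {ΦN : ℕ → EuclideanSpace ℝ (Fin n) → ℝ}
    (hoptN : ∀ N, IsOptimalPortfolio (PN N : Measure (openSimplex n × openSimplex n))
      (πN N) (ΦN N))
    {p₀ : openSimplex n} {φ' : openSimplex n → ℝ}
    (hφ' : ∀ p, Tendsto (fun k => normalizedLog p₀ (ΦN k) p) atTop (𝓝 (φ' p))) :
    ∀ᵐ p ∂(surfaceMeasure n), f p ≠ 0 → IsGenerator φ' p (π p) := by
  set φ := normalizedLog p₀ Φ
  set φN := fun k => normalizedLog p₀ (ΦN k)
  have hgen : ∀ p, IsGenerator φ p (π p) := hopt.1.isGenerator p₀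
  have hgenN : ∀ k p, IsGenerator (φN k) p (πN k p) := fun k => (hoptN k).1.isGenerator p₀
  have hL := isLogLipschitz_of_isGenerator hgen
  have hLN := fun k => isLogLipschitz_of_isGenerator (hgenN k)
  have hL' := IsLogLipschitz.of_tendsto hLN hφ'
  obtain ⟨C, hC⟩ := exists_abs_logGap_le hK
  have hmem := fun p => (hgen p).1
  have hmemN := fun k p => (hgenN k p).1
  -- continuous convergence of the weights at almost every point
  let Good : openSimplex n → EuclideanSpace ℝ (Fin n) → Prop := fun p w =>
    IsGenerator φ' p w ∧
      Tendsto (fun z : ℕ × openSimplex n => πN z.1 z.2) (atTop ×ˢ 𝓝 p) (𝓝 w) ∧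
      Tendsto (fun z : ℕ × openSimplex n => π z.2) (atTop ×ˢ 𝓝 p) (𝓝 (π p))
  have hgood : ∀ᵐ p ∂(surfaceMeasure n), ∃ w, Good p w := by
    filter_upwards [ae_unique_generator hL, ae_unique_generator hL'] with p hu hu'
    obtain ⟨w, hw, hlim⟩ := exists_tendsto_generator hφ' hgenN hu'
    obtain ⟨w₂, hw₂, hlim₂⟩ := exists_tendsto_generator (φ := fun _ => φ) (π := fun _ => π)
      (fun q => tendsto_const_nhds (x := φ q)) (fun _ => hgen) hu
    rw [hu w₂ (π p) hw₂ (hgen p)] at hlim₂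
    exact ⟨w, hw, hlim, hlim₂⟩
  -- The value `0` at bad points is arbitrary. The resulting `π'` is not known to be a measurable
  -- portfolio, so optimality is only ever tested against the approximating pairs.
  have hsel : ∀ p, ∃ w, (∃ w', Good p w') → Good p w := fun p => by
    by_cases h : ∃ w', Good p w'
    · exact ⟨h.choose, fun _ => h.choose_spec⟩
    · exact ⟨0, fun h' => absurd h' h⟩
  choose π' hπ' using hsel
  have hPgood : ∀ᵐ z ∂(P : Measure (openSimplex n × openSimplex n)), Good z.1 (π' z.1) := by
    have h1 : ∀ᵐ p ∂(P : Measure (openSimplex n × openSimplex n)).fst, Good p (π' p) := by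
      rw [hPf]
      refine (withDensity_absolutelyContinuous _ _).ae_le ?_
      filter_upwards [hgood] with p hp using hπ' p hp
    exact ae_of_ae_map measurable_fst.aemeasurable h1
  have hKae : ∀ Q : Measure (openSimplex n × openSimplex n), Q (K ×ˢ K)ᶜ = 0 →
      ∀ᵐ z ∂Q, z.1 ∈ K ∧ z.2 ∈ K := fun Q hQ => hQ
  -- bounds, measurability and continuous convergence of the L-divergences
  let mid : (openSimplex n → ℝ) → openSimplex n → ℝ := fun ψ p => (φ p + ψ p) / 2
  let avg : (openSimplex n → EuclideanSpace ℝ (Fin n)) → openSimplex n →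
    EuclideanSpace ℝ (Fin n) := fun ρ p => (1 / 2 : ℝ) • (π p + ρ p)
  let T : openSimplex n × openSimplex n → ℝ := fun z => logGap φ (π z.1) z.1 z.2
  let TN : ℕ → openSimplex n × openSimplex n → ℝ := fun k z => logGap (φN k) (πN k z.1) z.1 z.2
  let T' : openSimplex n × openSimplex n → ℝ := fun z => logGap φ' (π' z.1) z.1 z.2
  let MN : ℕ → openSimplex n × openSimplex n → ℝ := fun k z =>
    logGap (mid (φN k)) (avg (πN k) z.1) z.1 z.2
  let M' : openSimplex n × openSimplex n → ℝ := fun z => logGap (mid φ') (avg π' z.1) z.1 z.2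
  have hTm : Measurable T := measurable_logGap hL hopt.1.isPortfolio.1
  have hTNm : ∀ k, Measurable (TN k) := fun k =>
    measurable_logGap (hLN k) (hoptN k).1.isPortfolio.1
  have hMNm : ∀ k, Measurable (MN k) := fun k => measurable_logGap (hL.midpoint (hLN k))
    (hopt.1.midpoint (hoptN k).1).isPortfolio.1
  have hTb : ∀ z : openSimplex n × openSimplex n, z.1 ∈ K ∧ z.2 ∈ K → |T z| ≤ C := fun z hz =>
    hC _ hL _ (hmem _) _ hz.1 _ hz.2
  have hTNb : ∀ k, ∀ z : openSimplex n × openSimplex n, z.1 ∈ K ∧ z.2 ∈ K → |TN k z| ≤ C :=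
    fun k z hz => hC _ (hLN k) _ (hmemN k _) _ hz.1 _ hz.2
  have hMNb : ∀ k, ∀ z : openSimplex n × openSimplex n, z.1 ∈ K ∧ z.2 ∈ K → |MN k z| ≤ C :=
    fun k z hz => hC _ (hL.midpoint (hLN k)) _
      (mem_closedSimplex_midpoint (hmem _) (hmemN k _)) _ hz.1 _ hz.2
  have hT'b : ∀ᵐ z ∂(P : Measure (openSimplex n × openSimplex n)), |T' z| ≤ C := by
    filter_upwards [hPgood, hKae _ hPK] with z hg hz using hC _ hL' _ hg.1.1 _ hz.1 _ hz.2
  have hM'b : ∀ᵐ z ∂(P : Measure (openSimplex n × openSimplex n)), |M' z| ≤ C := by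
    filter_upwards [hPgood, hKae _ hPK] with z hg hz using
      hC _ (hL.midpoint hL') _ (mem_closedSimplex_midpoint (hmem _) hg.1.1) _ hz.1 _ hz.2
  have hTlim : ∀ᵐ z ∂(P : Measure (openSimplex n × openSimplex n)), Tendsto
      (fun x : ℕ × openSimplex n × openSimplex n => T x.2) (atTop ×ˢ 𝓝 z) (𝓝 (T z)) := by
    filter_upwards [hPgood] with z hg
    exact tendsto_logGap (φ := fun _ => φ) (π := fun _ => π) (fun _ => hL)
      (fun q => tendsto_const_nhds (x := φ q)) (hmem _) hg.2.2
  have hTNlim : ∀ᵐ z ∂(P : Measure (openSimplex n × openSimplex n)), Tendsto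
      (fun x : ℕ × openSimplex n × openSimplex n => TN x.1 x.2) (atTop ×ˢ 𝓝 z) (𝓝 (T' z)) := by
    filter_upwards [hPgood] with z hg
    exact tendsto_logGap hLN hφ' hg.1.1 hg.2.1
  have hMNlim : ∀ᵐ z ∂(P : Measure (openSimplex n × openSimplex n)), Tendsto
      (fun x : ℕ × openSimplex n × openSimplex n => MN x.1 x.2) (atTop ×ˢ 𝓝 z) (𝓝 (M' z)) := by
    filter_upwards [hPgood] with z hg
    exact tendsto_logGap (φ := fun k => mid (φN k)) (π := fun k => avg (πN k))
      (fun k => hL.midpoint (hLN k)) (fun q => (tendsto_const_nhds.add (hφ' q)).div_const 2)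
      (mem_closedSimplex_midpoint (hmem _) hg.1.1)
      ((hg.2.2.add hg.2.1).const_smul (1 / 2 : ℝ))
  have hint : ∀ (Q : ProbabilityMeasure (openSimplex n × openSimplex n)),
      (Q : Measure (openSimplex n × openSimplex n)) (K ×ˢ K)ᶜ = 0 →
      ∀ g : openSimplex n × openSimplex n → ℝ, Measurable g →
      (∀ z : openSimplex n × openSimplex n, z.1 ∈ K ∧ z.2 ∈ K → |g z| ≤ C) →
      Integrable g (Q : Measure (openSimplex n × openSimplex n)) := fun Q hQ g hg hb =>
    Integrable.of_bound hg.aestronglyMeasurable C ((hKae _ hQ).mono fun z hz => hb z hz)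
  -- the two optimality conditions
  have hMT : ∫ z, (M' z - T' z) ∂(P : Measure (openSimplex n × openSimplex n)) ≤ 0 := by
    refine integral_nonpos_of_tendsto (C := C + C) hconv
      (h := fun k z => MN k z - TN k z) (fun k => (hMNm k).sub (hTNm k))
      (fun k => (hKae _ (hPNK k)).mono fun z hz =>
        (abs_sub _ _).trans (add_le_add (hMNb k z hz) (hTNb k z hz)))
      (by filter_upwards [hT'b, hM'b] with z h1 h2 using (abs_sub _ _).trans (add_le_add h2 h1))
      (by filter_upwards [hTNlim, hMNlim] with z h1 h2 using h2.sub h1) fun k => ?_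
    rw [integral_sub (hint _ (hPNK k) _ (hMNm k) (hMNb k)) (hint _ (hPNK k) _ (hTNm k) (hTNb k)),
      sub_nonpos]
    -- The competitor for `PN k` is the average of `π` and `πN k`.
    have h1 := (hoptN k).2 _ _ (hopt.1.midpoint (hoptN k).1)
    simp only [(hoptN k).1.lDivergence_eq p₀, (hopt.1.midpoint (hoptN k).1).lDivergence_eq p₀,
      normalizedLog_midpoint hopt.1.pos (hoptN k).1.pos] at h1
    exact h1
  have hTT : ∫ z, (T' z - T z) ∂(P : Measure (openSimplex n × openSimplex n)) ≤ 0 := by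
    refine integral_nonpos_of_tendsto (C := C + C) (PN := fun _ => P) tendsto_const_nhds
      (h := fun k z => TN k z - T z) (fun k => (hTNm k).sub hTm)
      (fun k => (hKae _ hPK).mono fun z hz =>
        (abs_sub _ _).trans (add_le_add (hTNb k z hz) (hTb z hz)))
      (by
        filter_upwards [hT'b, hKae _ hPK] with z h1 hz using
          (abs_sub _ _).trans (add_le_add h1 (hTb z hz)))
      (by filter_upwards [hTNlim, hTlim] with z h1 h2 using h1.sub h2) fun k => ?_
    rw [integral_sub (hint _ hPK _ (hTNm k) (hTNb k)) (hint _ hPK _ hTm hTb), sub_nonpos]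
    have h1 := hopt.2 _ _ (hoptN k).1
    simp only [(hoptN k).1.lDivergence_eq p₀, hopt.1.lDivergence_eq p₀] at h1
    exact h1
  -- Measurability of `T'` and `M'` comes from their being almost everywhere limits of measurable
  -- functions.
  have hlimseq : ∀ (g : ℕ → openSimplex n × openSimplex n → ℝ)
      (g' : openSimplex n × openSimplex n → ℝ), (∀ k, Measurable (g k)) →
      (∀ᵐ z ∂(P : Measure (openSimplex n × openSimplex n)), Tendsto
        (fun x : ℕ × openSimplex n × openSimplex n => g x.1 x.2) (atTop ×ˢ 𝓝 z) (𝓝 (g' z))) →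
      (∀ᵐ z ∂(P : Measure (openSimplex n × openSimplex n)), |g' z| ≤ C) →
      Integrable g' (P : Measure (openSimplex n × openSimplex n)) := fun g g' hg hl hb => by
    refine Integrable.of_bound (aestronglyMeasurable_of_tendsto_ae atTop
      (fun k => (hg k).aestronglyMeasurable) ?_) C hb
    filter_upwards [hl] with z hz
    exact hz.comp (tendsto_id.prodMk (tendsto_const_nhds (x := z)))
  have hT'i := hlimseq TN T' hTNm hTNlim hT'b
  have hM'i := hlimseq MN M' hMNm hMNlim hM'b
  have hTi := hint P hPK T hTm hTb
  have hMTi : Integrable (fun z => M' z - T' z)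
      (P : Measure (openSimplex n × openSimplex n)) := hM'i.sub hT'i
  have hTTi : Integrable (fun z => 1 / 2 * (T' z - T z))
      (P : Measure (openSimplex n × openSimplex n)) := (hT'i.sub hTi).const_mul _
  -- The sum equals `M' - (T + T') / 2`, in which the `φ` terms cancel and the concavity gap of the
  -- logarithm remains. Optimality makes its integral nonpositive, so the gap vanishes almost
  -- everywhere.
  have hDnonneg : ∀ᵐ z ∂(P : Measure (openSimplex n × openSimplex n)),
      0 ≤ (M' z - T' z) + (1 / 2) * (T' z - T z) := by
    filter_upwards [hPgood] with z hg
    have h1 := log_add_log_le_two_mul_log (relReturn_pos (hmem z.1) z.1 z.2)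
      (relReturn_pos hg.1.1 z.1 z.2)
    simp only [M', T', T, logGap, avg, mid, relReturn_midpoint]
    linarith
  have hD0 : ∫ z, ((M' z - T' z) + (1 / 2) * (T' z - T z))
      ∂(P : Measure (openSimplex n × openSimplex n)) = 0 := by
    refine le_antisymm ?_ (integral_nonneg_of_ae hDnonneg)
    rw [integral_add hMTi hTTi, integral_const_mul]
    linarith
  rw [integral_eq_zero_iff_of_nonneg_ae hDnonneg (hMTi.add hTTi)] at hD0
  have heq : ∀ᵐ z ∂(P : Measure (openSimplex n × openSimplex n)),
      relReturn (π z.1) z.1 z.2 = relReturn (π' z.1) z.1 z.2 := by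
    filter_upwards [hPgood, hD0] with z hg hz
    refine eq_of_log_midpoint_eq (relReturn_pos (hmem z.1) z.1 z.2)
      (relReturn_pos hg.1.1 z.1 z.2) ?_
    simp only [M', T', T, logGap, avg, mid, relReturn_midpoint, Pi.zero_apply] at hz
    linarith
  rw [hPκ] at heq
  have h1 := Measure.ae_ae_of_ae_compProd heq
  rw [hPf, ae_withDensity_iff hf] at h1
  filter_upwards [h1, hsupp, hgood] with p hp hs hg hfp
  have hg' := hπ' p hg
  rw [eq_of_relReturn_eq_on_support (hmem p) hg'.1.1 (hp hfp) (hs (pos_iff_ne_zero.2 hfp))]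
  exact hg'.1

/-! ### Monotonicity of generators and rigidity at density points. -/

/-- Monotonicity: if the generators of `φ'` at points approaching `p` in the direction `v`
converge to `w'`, then `w'` is below every generator `w` of `φ'` at `p` in the direction `v`. -/
lemma sum_div_mul_le_of_tendsto {φ' : openSimplex n → ℝ} {p : openSimplex n}
    {w w' v : EuclideanSpace ℝ (Fin n)} (hw : IsGenerator φ' p w)
    {x : ℕ → openSimplex n} {y : ℕ → EuclideanSpace ℝ (Fin n)} {t : ℕ → ℝ}
    (ht : ∀ k, 0 < t k) (ht0 : Tendsto t atTop (𝓝 0)) (hx : Tendsto x atTop (𝓝 p))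
    (hv : Tendsto (fun k => (t k)⁻¹ • ((x k).1 - p.1)) atTop (𝓝 v))
    (hy : ∀ k, IsGenerator φ' (x k) (y k)) (hyw : Tendsto y atTop (𝓝 w')) :
    ∑ i, w' i / p.1 i * v i ≤ ∑ i, w i / p.1 i * v i := by
  let u : ℕ → EuclideanSpace ℝ (Fin n) := fun k => (t k)⁻¹ • ((x k).1 - p.1)
  have hu : ∀ k i, (x k).1 i - p.1 i = t k * u k i := fun k i => by
    simp [u, mul_inv_cancel_left₀ (ht k).ne']
  let α : ℕ → ℝ := fun k => ∑ i, w i / p.1 i * u k i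
  let β : ℕ → ℝ := fun k => ∑ i, y k i / (x k).1 i * u k i
  have hcoord : ∀ {g : ℕ → EuclideanSpace ℝ (Fin n)} {b : EuclideanSpace ℝ (Fin n)},
      Tendsto g atTop (𝓝 b) → ∀ i, Tendsto (fun k => g k i) atTop (𝓝 (b i)) := fun {g b} hg i =>
    ((EuclideanSpace.proj (𝕜 := ℝ) i : EuclideanSpace ℝ (Fin n) →L[ℝ] ℝ).continuous.tendsto b).comp hg
  have hα : Tendsto α atTop (𝓝 (∑ i, w i / p.1 i * v i)) :=
    tendsto_finsetSum _ fun i _ => (hcoord hv i).const_mul _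
  have hβ : Tendsto β atTop (𝓝 (∑ i, w' i / p.1 i * v i)) :=
    tendsto_finsetSum _ fun i _ => ((hcoord hyw i).div
      (((continuous_openSimplex_coord i).tendsto p).comp hx)
      (openSimplex.coord_pos p i).ne').mul (hcoord hv i)
  -- Multiplying the generator inequalities from `p` to `x k` and back cancels the exponentials: `1
  -- ≤ (1 + t α) (1 - t β)`. Then divide by `t`.
  have hkey : ∀ k, 0 ≤ α k - β k - t k * (α k * β k) := fun k => by
    have hA : relReturn w p (x k) = 1 + t k * α k := by
      have h1 := relReturn_sub_one hw.1 p (x k)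
      simp only [hu, mul_left_comm _ (t k), ← Finset.mul_sum] at h1
      change _ = t k * α k at h1
      linarith
    have hB : relReturn (y k) (x k) p = 1 - t k * β k := by
      have h1 := relReturn_sub_one (hy k).1 (x k) p
      have h2 : ∀ i, p.1 i - (x k).1 i = t k * -(u k i) := fun i => by linarith [hu k i]
      simp only [h2, mul_left_comm _ (t k), ← Finset.mul_sum, mul_neg, Finset.sum_neg_distrib] at h1
      change _ = -(t k * β k) at h1
      linarith
    have h1 := hw.2 (x k)
    have h2 := (hy k).2 p
    have h3 := mul_le_mul h1 h2 (Real.exp_pos _).le (relReturn_pos hw.1 _ _).le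
    rw [← Real.exp_add, hA, hB] at h3
    simp only [sub_add_sub_cancel, sub_self, Real.exp_zero] at h3
    refine nonneg_of_mul_nonneg_right (a := t k) ?_ (ht k)
    linarith
  have hlim := (hα.sub hβ).sub (ht0.mul (hα.mul hβ))
  rw [zero_mul, sub_zero] at hlim
  exact sub_nonneg.1 (ge_of_tendsto' hlim hkey)

/-- At a point of density of a set on which `π` generates both `φ` and `φ'`, and at which the
generator of `φ` is unique, the generator of `φ'` is unique too, and equal to that of `φ`. -/
lemma eq_of_isGenerator_of_density {S : Set (openSimplex n)} {φ φ' : openSimplex n → ℝ}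
    {π : openSimplex n → EuclideanSpace ℝ (Fin n)} (hπ : ∀ q, IsGenerator φ q (π q))
    (hS : ∀ᵐ q ∂(surfaceMeasure n), q ∈ S → IsGenerator φ' q (π q)) {p : openSimplex n}
    (hu : ∀ w w', IsGenerator φ p w → IsGenerator φ p w' → w = w')
    (hcone : ∀ v : EuclideanSpace ℝ (Fin n), ∑ i, v i = 0 →
      ∀ ε : ℝ, 0 < ε → ∀ᶠ t in 𝓝[>] (0 : ℝ),
        surfaceMeasure n (S ∩ {q | ‖q.1 - p.1 - t • v‖ ≤ t * ε}) ≠ 0)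
    {w : EuclideanSpace ℝ (Fin n)} (hw : IsGenerator φ' p w) : π p = w := by
  let v := π p - w
  have hv : ∑ i, v i = 0 := by simp [v, (hπ p).1.2, hw.1.2]
  let ε : ℕ → ℝ := fun k => 1 / ((k : ℝ) + 1)
  have hε : ∀ k, 0 < ε k := fun k => by positivity
  have hε0 : Tendsto ε atTop (𝓝 0) := tendsto_one_div_add_atTop_nhds_zero_nat
  -- A set of positive measure is not contained in the null set where `π` fails to generate `φ'` on
  -- `S`, so each thin cone around `v = π p - w` contains a usable point.
  have hex : ∀ k, ∃ t, 0 < t ∧ t < ε k ∧ ∃ q : openSimplex n,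
      ‖q.1 - p.1 - t • v‖ ≤ t * ε k ∧ IsGenerator φ' q (π q) := fun k => by
    have hlt : ∀ᶠ t in 𝓝[>] (0 : ℝ), t < ε k :=
      (eventually_lt_nhds (hε k)).filter_mono nhdsWithin_le_nhds
    obtain ⟨t, ⟨ht, htε⟩, ht0⟩ := ((hcone v hv _ (hε k)).and hlt).and self_mem_nhdsWithin |>.exists
    refine ⟨t, ht0, htε, ?_⟩
    by_contra! hcon
    refine ht (measure_mono_null ?_ (ae_iff.1 hS))
    exact fun q hq hq' => hcon q hq.2 (hq' hq.1)
  choose t ht htε x hxt hx using hex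
  have ht0 : Tendsto t atTop (𝓝 0) :=
    squeeze_zero (fun k => (ht k).le) (fun k => (htε k).le) hε0
  have hdir : Tendsto (fun k => (t k)⁻¹ • ((x k).1 - p.1)) atTop (𝓝 v) := by
    rw [tendsto_iff_norm_sub_tendsto_zero]
    refine squeeze_zero (fun k => norm_nonneg _) (fun k => ?_) hε0
    have h1 : (t k)⁻¹ • ((x k).1 - p.1) - v = (t k)⁻¹ • ((x k).1 - p.1 - t k • v) := by
      rw [smul_sub _ ((x k).1 - p.1) (t k • v), inv_smul_smul₀ (ht k).ne']
    rw [h1, norm_smul, norm_inv, Real.norm_of_nonneg (ht k).le, inv_mul_le_iff₀ (ht k)]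
    exact hxt k
  have hxp : Tendsto x atTop (𝓝 p) := by
    rw [tendsto_subtype_rng]
    have h1 := (ht0.smul hdir).add_const p.1
    rw [zero_smul, zero_add] at h1
    refine h1.congr fun k => ?_
    rw [smul_inv_smul₀ (ht k).ne', sub_add_cancel]
  have hπlim : Tendsto (fun k => π (x k)) atTop (𝓝 (π p)) := by
    obtain ⟨w₂, hw₂, hlim₂⟩ := exists_tendsto_generator (φ := fun _ => φ) (π := fun _ => π)
      (fun q => tendsto_const_nhds (x := φ q)) (fun _ => hπ) hu
    rw [hu w₂ (π p) hw₂ (hπ p)] at hlim₂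
    exact hlim₂.comp (tendsto_id.prodMk hxp)
  exact eq_of_sum_div_mul_le (p := p) (sum_div_mul_le_of_tendsto hw ht ht0 hxp hdir hx hπlim)

end

theorem theorem5p5 (n : ℕ) (hn : 2 ≤ n)
    (K : Set (openSimplex n)) (hK : IsCompact K)
    (P : ProbabilityMeasure (openSimplex n × openSimplex n))
    (hPK : (P : Measure (openSimplex n × openSimplex n)) (K ×ˢ K)ᶜ = 0)
    (hPac : IsAbsCont (P : Measure (openSimplex n × openSimplex n)))
    (f : openSimplex n → ℝ≥0∞) (hf : Measurable f)
    (hPf : (P : Measure (openSimplex n × openSimplex n)).fst = (surfaceMeasure n).withDensity f)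
    (κ : Kernel (openSimplex n) (openSimplex n)) [IsMarkovKernel κ]
    (hPκ : (P : Measure (openSimplex n × openSimplex n)) =
      (P : Measure (openSimplex n × openSimplex n)).fst ⊗ₘ κ)
    (hsupp : SupportCondition f κ)
    (π : openSimplex n → EuclideanSpace ℝ (Fin n)) (Φ : EuclideanSpace ℝ (Fin n) → ℝ)
    (hopt : IsOptimalPortfolio (P : Measure (openSimplex n × openSimplex n)) π Φ)
    (PN : ℕ → ProbabilityMeasure (openSimplex n × openSimplex n))
    (hPNK : ∀ N, (PN N : Measure (openSimplex n × openSimplex n)) (K ×ˢ K)ᶜ = 0)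
    (hPNda : ∀ N, IsDiscreteMeasure (PN N : Measure (openSimplex n × openSimplex n)) ∨
      IsAbsCont (PN N : Measure (openSimplex n × openSimplex n)))
    (hconv : Tendsto PN atTop (𝓝 P))
    (πN : ℕ → openSimplex n → EuclideanSpace ℝ (Fin n))
    (ΦN : ℕ → EuclideanSpace ℝ (Fin n) → ℝ)
    (hoptN : ∀ N, IsOptimalPortfolio (PN N : Measure (openSimplex n × openSimplex n))
      (πN N) (ΦN N)) :
    ∀ᵐ p ∂(surfaceMeasure n), 0 < f p → Tendsto (fun N => πN N p) atTop (𝓝 (π p)) := by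
  have hne : Nonempty (openSimplex n × openSimplex n) :=
    nonempty_of_isProbabilityMeasure (P : Measure (openSimplex n × openSimplex n))
  obtain ⟨⟨p₀, -⟩⟩ := hne
  have hgen : ∀ p, IsGenerator (normalizedLog p₀ Φ) p (π p) := hopt.1.isGenerator p₀
  have hgenN : ∀ k p, IsGenerator (normalizedLog p₀ (ΦN k)) p (πN k p) := fun k =>
    (hoptN k).1.isGenerator p₀
  have hS : MeasurableSet {p | f p ≠ 0} := (hf (measurableSet_singleton 0)).compl
  -- Both conditions on `p` involve only `Φ` and `f`, so the null set is fixed before any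
  -- subsequence is chosen.
  filter_upwards [ae_unique_generator (isLogLipschitz_of_isGenerator hgen),
    ae_pos_measure_inter_cone hS] with p hu hcone hfp
  refine tendsto_of_subseq_tendsto fun ns hns => ?_
  obtain ⟨s, hs, φ', hφ'⟩ := exists_subseq_tendsto_of_isLogLipschitz
    (φ := fun k => normalizedLog p₀ (ΦN (ns k)))
    (fun k => isLogLipschitz_of_isGenerator (hgenN (ns k))) p₀ (fun k => sub_self _)
  -- This further extraction depends on `p`, which is harmless because `p` is now fixed.
  obtain ⟨w, -, r, hr, hw⟩ := isCompact_closedSimplex.tendsto_subseq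
    (x := fun k => πN (ns (s k)) p) (fun k => (hgenN _ p).1)
  have hφr : ∀ q, Tendsto (fun k => normalizedLog p₀ (ΦN (ns (s (r k)))) q) atTop (𝓝 (φ' q)) :=
    fun q => (hφ' q).comp hr.tendsto_atTop
  have hsub : Tendsto (fun k => ns (s (r k))) atTop atTop :=
    hns.comp (hs.tendsto_atTop.comp hr.tendsto_atTop)
  have hwgen : IsGenerator φ' p w :=
    IsGenerator.of_tendsto hφr (hφr p) (tendsto_const_nhds (x := p)) hw fun k => hgenN _ p
  -- This statement need not hold at `p` itself; it is used only through nearby points of `{f ≠ 0}`.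
  have hlim := ae_isGenerator_of_tendsto_optimal hK hPK hf hPf hPκ hsupp hopt
    (fun k => hPNK (ns (s (r k)))) (hconv.comp hsub) (fun k => hoptN (ns (s (r k)))) hφr
  have heq := eq_of_isGenerator_of_density hgen hlim hu (hcone hfp.ne') hwgen
  exact ⟨fun k => s (r k), heq ▸ hw⟩
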